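/- Let $G$ be a compact connected (smooth, real) Lie group with Lie algebra $\mathfrak g$ of left-invariant vector fields (identified with $T_eG$), Killing form $B(X,Y)=\operatorname{tr}(\operatorname{ad}(X)\operatorname{ad}(Y))$, exponential map $X\mapsto \mathbf e^{X}$ and adjoint representation $\operatorname{Ad}$, and put $V:G\to\mathbb R$, $V(x)=\operatorname{tr}\operatorname{Ad}(x)$. Suppose that $G$ is semisimple, i.e. that the radical of $\mathfrak g$ is zero. Let $x\in Z(G)$ be a central element. Then the following hold. 1. $x$ is a non-degenerate critical point of $V$: $V$ is smooth near $x$, $\mathrm dV_x=0$, and the Hessian of $V$ at $x$ in a chart around $x$ is a non-degenerate bilinear form. 2. For every basis $Y_1,\dots,Y_n$ of $\mathfrak g$, the map $\varphi:\mathbb R^n\to G$, $\varphi(s_1,\dots,s_n)=x\cdot\mathbf e^{s_1Y_1}\cdots\mathbf e^{s_nY_n}$ (coordinates of the second kind), satisfies $\varphi(0)=x$, is a smooth local diffeomorphism at $0$ with $\mathrm d\varphi_0(\partial/\partial s_j)=Y_j(x)$ for all $j$, and $$\left.\frac{\partial^2 (V\circ\varphi)}{\partial s_j\,\partial s_k}\right|_{s=0}=B(Y_j,Y_k)\qquad\text{for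 all } j,k.$$ (In particular, the Hessian matrix is $-\mathrm{Id}$ if the basis is orthonormal with respect to $-B$.) 3. Let $X_1,\dots,X_m\in\mathfrak g$, and let $(\mathbf x_r,u_1^r,\dots,u_m^r)$ be a $T$-periodic ($T>0$) smooth trajectory of the system $\mathbf x'=\sum_{k} u_kX_k(\mathbf x)$; that is, the $u^r_k:\mathbb R\to\mathbb R$ are $C^\infty$ and $T$-periodic, and $\mathbf x_r:\mathbb R\to G$ is $T$-periodic with $\mathbf x_r'(t)=\sum_k u^r_k(t)X_k(\mathbf x_r(t))$. Suppose the trajectory is regular, i.e. the vectors $\operatorname{Ad}(\mathbf x_r(t))X_k$ ($t\in\mathbb R$, $1\le k\le m$) span $\mathfrak g$. Put $W(t,w)=\sum_{k} a_k(t,w)\,\bigl(\operatorname{Ad}(\mathbf x_r(t))X_k\bigr)(w)$, where $a_k(t,w)=\mathrm dV\bigl((\operatorname{Ad}(\mathbf x_r(t))X_k)(w)\bigr)$, and $\mathcal C_W=\{w\in G: W(t,w)=0\ \ \forall t\in\mathbb R\}$. Then $x$ is an isolated point of $\mathcal C_W$: $x\in\mathcal C_W$, and $U\cap\mathcal C_W=\{x\}$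 for some open $U\subset G$. -/

import Mathlib

open scoped Manifold ContDiff Topology

noncomputable section

namespace LieTracking

/-- A smooth real Lie group has the regularity needed for its Lie algebra `GroupLieAlgebra I G`. -/
instance instLEInftyMinSmoothnessReal : ENat.LEInfty (minSmoothness ℝ 3) := by
  rw [minSmoothness_of_isRCLikeNormedField]
  infer_instance

section Defs

variable {E : Type*} [NormedAddCommGroup E] [NormedSpace ℝ E]
  {H : Type*} [TopologicalSpace H] (I : ModelWithCorners ℝ E H)
  {G : Type*} [TopologicalSpace G] [ChartedSpace H G] [Group G]

/-- The adjoint map `Ad(x) = d(I_x)_e : T_e G → T_e G`, where `I_x y = x y x⁻¹`.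
(The target `T_{x e x⁻¹} G` of the differential is `T_e G`, because `x e x⁻¹ = e`.) -/
def Ad (x : G) : GroupLieAlgebra I G →L[ℝ] GroupLieAlgebra I G :=
  mfderiv I I (fun y : G => x * y * x⁻¹) 1

/-- The Lyapunov-like function `V = tr ∘ Ad`. -/
def V (x : G) : ℝ :=
  LinearMap.trace ℝ (GroupLieAlgebra I G) (Ad I x).toLinearMap

/-- `(x, u₁, …, u_m)` is a smooth trajectory of the left-invariant driftless system
`x' = ∑ k, u_k X_k(x)`. -/
structure IsTrajectory {m : ℕ} (X : Fin m → GroupLieAlgebra I G)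
    (x : ℝ → G) (u : Fin m → ℝ → ℝ) : Prop where
  smooth_control : ∀ k, ContDiff ℝ ∞ (u k)
  integral_curve : ∀ t : ℝ, HasMFDerivAt 𝓘(ℝ, ℝ) I x t
    ((1 : ℝ →L[ℝ] ℝ).smulRight (∑ k, u k t • mulInvariantVectorField (X k) (x t)))

/-- `(x, u₁, …, u_m)` is a `T`-periodic trajectory, `T > 0`. -/
structure IsPeriodicTrajectory {m : ℕ} (X : Fin m → GroupLieAlgebra I G)
    (x : ℝ → G) (u : Fin m → ℝ → ℝ) (T : ℝ) : Prop extends IsTrajectory I X x u where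
  period_pos : 0 < T
  periodic_state : Function.Periodic x T
  periodic_control : ∀ k, Function.Periodic (u k) T

/-- Regularity: the vectors `Ad(x(t)) X_k`, `t ∈ ℝ`, `1 ≤ k ≤ m`, span the Lie algebra. -/
def IsRegular {m : ℕ} (X : Fin m → GroupLieAlgebra I G) (x : ℝ → G) : Prop :=
  Submodule.span ℝ (Set.range fun p : ℝ × Fin m => Ad I (x p.1) (X p.2)) = ⊤

/-- `a_k(t, w) = dV (Ad(x_r(t)) X_k (w))`. Here `Ad(x_r(t)) X_k` is an element of the Lie algebra
and is evaluated at `w` as a left-invariant vector field. -/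
def feedback {m : ℕ} (X : Fin m → GroupLieAlgebra I G) (xr : ℝ → G)
    (k : Fin m) (t : ℝ) (w : G) : ℝ :=
  mfderiv I 𝓘(ℝ, ℝ) (V I) w (mulInvariantVectorField (Ad I (xr t) (X k)) w)

/-- The auxiliary time-dependent vector field
`W(t, w) = ∑ k, a_k(t, w) Ad(x_r(t)) X_k (w)`. -/
def auxField {m : ℕ} (X : Fin m → GroupLieAlgebra I G) (xr : ℝ → G)
    (t : ℝ) (w : G) : TangentSpace I w :=
  ∑ k, feedback I X xr k t w • mulInvariantVectorField (Ad I (xr t) (X k)) w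

/-- `C_W`, the set of all `w` such that `W(t, w) = 0` for all `t`. -/
def criticalSet {m : ℕ} (X : Fin m → GroupLieAlgebra I G) (xr : ℝ → G) : Set G :=
  {w | ∀ t : ℝ, auxField I X xr t w = 0}

end Defs

/-- The Hessian of a real function on a normed space, as a bilinear form. -/
def hessian {F : Type*} [NormedAddCommGroup F] [NormedSpace ℝ F] (f : F → ℝ) (p : F) :
    F →L[ℝ] F →L[ℝ] ℝ :=
  fderiv ℝ (fderiv ℝ f) p

/-- `x` is a non-degenerate critical point of the function `f` on a manifold without boundary:
`f` is smooth near `x`, `df_x = 0`, and the Hessian of `f` at `x` in a chart around `x` is a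
non-degenerate bilinear form (at a critical point this does not depend on the chart). -/
structure IsNondegenerateCriticalPoint {E : Type*} [NormedAddCommGroup E] [NormedSpace ℝ E]
    {H : Type*} [TopologicalSpace H] (I : ModelWithCorners ℝ E H)
    {M : Type*} [TopologicalSpace M] [ChartedSpace H M] (f : M → ℝ) (x : M) : Prop where
  smooth : ∀ᶠ y in 𝓝 x, ContMDiffAt I 𝓘(ℝ, ℝ) ∞ f y
  critical : mfderiv I 𝓘(ℝ, ℝ) f x = 0
  nondegenerate : ∀ v : E,
    (∀ w : E, hessian (f ∘ (extChartAt I x).symm) (extChartAt I x x) v w = 0) → v = 0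

/-- `x` is an isolated point of `S`. -/
def IsIsolatedPoint {M : Type*} [TopologicalSpace M] (S : Set M) (x : M) : Prop :=
  x ∈ S ∧ ∃ U : Set M, IsOpen U ∧ U ∩ S = {x}

section Exp

variable {E : Type*} [NormedAddCommGroup E] [NormedSpace ℝ E]
  {H : Type*} [TopologicalSpace H] (I : ModelWithCorners ℝ E H)
  {G : Type*} [TopologicalSpace G] [ChartedSpace H G] [Group G]
  [CompleteSpace E] [LieGroup I ∞ G] [T2Space G] [BoundarylessManifold I G]

/-- The left-invariant vector field of `X` has a global integral curve through the identity. -/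
theorem exists_oneParameter (X : GroupLieAlgebra I G) :
    ∃ γ : ℝ → G, γ 0 = 1 ∧ IsMIntegralCurve γ (mulInvariantVectorField (I := I) X) := by
  have hv : ContMDiff I I.tangent 1
      (fun g : G => (⟨g, mulInvariantVectorField (I := I) X g⟩ : TangentBundle I G)) :=
    (contMDiff_mulInvariantVectorField X).of_le
      (by rw [minSmoothness_of_isRCLikeNormedField]; norm_num)
  obtain ⟨γ, h0, hγ⟩ :=
    exists_isMIntegralCurveAt_of_contMDiffAt_boundaryless (t₀ := 0) (hv.contMDiffAt (x := (1 : G)))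
  obtain ⟨ε, hε, hγ⟩ := isMIntegralCurveAt_iff'.1 hγ
  refine exists_isMIntegralCurve_of_isMIntegralCurveOn hv hε (fun g => ?_) 1
  refine ⟨fun t => g * γ t, by simp [h0], fun t ht => ?_⟩
  have hL : HasMFDerivAt I I (fun y : G => g * y) (γ t)
      (mfderiv I I (fun y : G => g * y) (γ t)) :=
    ((contMDiff_mul_left (I := I) (n := ∞) (a := g)).mdifferentiableAt
      (by simp)).hasMFDerivAt
  have ht' : t ∈ Metric.ball (0 : ℝ) ε := by simpa [Real.ball_eq_Ioo] using ht
  have hγt : HasMFDerivAt 𝓘(ℝ, ℝ) I γ t _ :=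
    (hγ t ht').hasMFDerivAt (Metric.isOpen_ball.mem_nhds ht')
  have hL1 : MDifferentiableAt I I (fun y : G => γ t * y) 1 :=
    (contMDiff_mul_left (I := I) (n := ∞) (a := γ t)).mdifferentiableAt (by simp)
  have key : mfderiv I I (fun y : G => g * y) (γ t) (mulInvariantVectorField (I := I) X (γ t))
      = mulInvariantVectorField (I := I) X (g * γ t) := by
    have h := mfderiv_comp_apply_of_eq (I := I) (I' := I) (I'' := I) (x := (1 : G)) (y := γ t)
      hL.mdifferentiableAt hL1 (mul_one _) X
    have hc : (fun y : G => g * y) ∘ (fun y : G => γ t * y) = fun y : G => g * γ t * y := by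
      funext y; simp [mul_assoc]
    rw [hc] at h
    exact h.symm
  have h := (hL.comp t hγt).hasMFDerivWithinAt (s := Set.Ioo (-ε) ε)
  have hlin : (mfderiv I I (fun y : G => g * y) (γ t)).comp
      ((1 : ℝ →L[ℝ] ℝ).smulRight (mulInvariantVectorField (I := I) X (γ t))) =
      (1 : ℝ →L[ℝ] ℝ).smulRight (mulInvariantVectorField (I := I) X (g * γ t)) := by
    rw [← key]
    ext
    simp
  exact hlin ▸ h

/-- The exponential map of the Lie group: `exp X = γ(1)`, where `γ` is the integral curve of the
left-invariant vector field of `X` with `γ(0) = e`. -/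
def lieExp (X : GroupLieAlgebra I G) : G :=
  (exists_oneParameter I X).choose 1

/-- Coordinates of the second kind at `x`:
`φ(s₁, …, s_n) = x · exp(s₁ Y₁) · … · exp(s_n Y_n)`. -/
def secondKind {n : ℕ} (Y : Fin n → GroupLieAlgebra I G) (x : G) (s : Fin n → ℝ) : G :=
  x * (List.ofFn fun j => lieExp I (s j • Y j)).prod

end Exp

end LieTracking

end

/-! For central `x`, `Ad(x) = id` and `V(xg) = V(g)`, so everything reduces to the identity. The
derivative of `Ad(exp(sX))` at `s = 0` is `ad X`. In coordinates of the second kind the first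
derivatives of `V` are therefore `tr (ad Y_j)`. In the plane of the `j`-th and `k`-th coordinates
`V` is `tr (Ad(exp(aY_j)) Ad(exp(bY_k)))`; cyclicity of the trace absorbs the order of the factors,
and the mixed derivative is `tr (ad Y_j ad Y_k)`, the Killing form (`hessian_V_secondKind`).

Averaging over the compact group gives an `Ad`-invariant inner product, for which every `ad X` is
skew. Hence `tr (ad X) = 0`, so `x` is critical. Moreover `B(X, X) = tr ((ad X)²)` is minus a sum of
squares, so it vanishes only if `ad X = 0`, that is, for `X` in the center, which is zero when the
radical is (`eq_zero_of_killingForm_self`). The Hessian is thus definite in these coordinates, and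
at a critical point this passes to any chart.

If `W(t, w) = 0`, applying `dV` gives `∑ a_k² = 0`; regularity then forces `dV_w = 0`. A
non-degenerate critical point is isolated among critical points, so `x` is isolated in `C_W`.

The link between the bracket of left-invariant fields and `Ad` is `bracket_eq_adjointDeriv`. It
comes from differentiating `dL_g = dR_g ∘ Ad(g)` at the identity and from the symmetry of the second
derivative of the multiplication. -/

open scoped Manifold ContDiff Topology

noncomputable section

namespace LieTracking

/-! ### Multiplication and translations in the chart at the identity -/

section

variable {E : Type*} [NormedAddCommGroup E] [NormedSpace ℝ E]
  {G : Type*} [TopologicalSpace G] [ChartedSpace E G] [Group G]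

variable (E G) in
/-- The coordinates of the identity in the preferred chart at the identity. -/
def chartOne : E := extChartAt 𝓘(ℝ, E) (1 : G) 1

variable (G) in
/-- The group multiplication read in the preferred chart at the identity. -/
def chartMul (p : E × E) : E :=
  extChartAt 𝓘(ℝ, E) (1 : G)
    ((extChartAt 𝓘(ℝ, E) (1 : G)).symm p.1 * (extChartAt 𝓘(ℝ, E) (1 : G)).symm p.2)

variable (G) in
/-- The differential at the identity of left translation, read in the chart at the identity. -/
def chartLeft (a : E) : E →L[ℝ] E :=
  (fderiv ℝ (chartMul G) (a, chartOne E G)).comp (ContinuousLinearMap.inr ℝ E E)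

variable (G) in
/-- The differential at the identity of right translation, read in the chart at the identity. -/
def chartRight (a : E) : E →L[ℝ] E :=
  (fderiv ℝ (chartMul G) (chartOne E G, a)).comp (ContinuousLinearMap.inl ℝ E E)

lemma chartOne_mem : chartOne E G ∈ (extChartAt 𝓘(ℝ, E) (1 : G)).target :=
  mem_extChartAt_target _

@[simp] lemma symm_chartOne : (extChartAt 𝓘(ℝ, E) (1 : G)).symm (chartOne E G) = 1 :=
  extChartAt_to_inv _

lemma target_mem_nhds_chartOne :
    (extChartAt 𝓘(ℝ, E) (1 : G)).target ∈ 𝓝 (chartOne E G) :=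
  extChartAt_target_mem_nhds _

section LieGroup

variable [LieGroup 𝓘(ℝ, E) ∞ G]

lemma contMDiffAt_chart_symm (x : G) {a : E} (ha : a ∈ (extChartAt 𝓘(ℝ, E) x).target) :
    ContMDiffAt 𝓘(ℝ, E) 𝓘(ℝ, E) ∞ (extChartAt 𝓘(ℝ, E) x).symm a :=
  (contMDiffOn_extChartAt_symm x).contMDiffAt ((isOpen_extChartAt_target x).mem_nhds ha)

lemma contMDiffAt_chart (x : G) {y : G} (hy : y ∈ (extChartAt 𝓘(ℝ, E) x).source) :
    ContMDiffAt 𝓘(ℝ, E) 𝓘(ℝ, E) ∞ (extChartAt 𝓘(ℝ, E) x) y :=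
  contMDiffAt_extChartAt' (by simpa using hy)

lemma contDiffAt_chartMul {p : E × E} (h1 : p.1 ∈ (extChartAt 𝓘(ℝ, E) (1 : G)).target)
    (h2 : p.2 ∈ (extChartAt 𝓘(ℝ, E) (1 : G)).target)
    (h : (extChartAt 𝓘(ℝ, E) (1 : G)).symm p.1 * (extChartAt 𝓘(ℝ, E) (1 : G)).symm p.2 ∈
      (extChartAt 𝓘(ℝ, E) (1 : G)).source) :
    ContDiffAt ℝ ∞ (chartMul G) p := by
  rw [← contMDiffAt_iff_contDiffAt]
  have e1 : ContMDiffAt 𝓘(ℝ, E × E) 𝓘(ℝ, E) ∞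
      (fun p : E × E => (extChartAt 𝓘(ℝ, E) (1 : G)).symm p.1) p :=
    ContMDiffAt.comp p (contMDiffAt_chart_symm 1 h1) contDiff_fst.contMDiff.contMDiffAt
  have e2 : ContMDiffAt 𝓘(ℝ, E × E) 𝓘(ℝ, E) ∞
      (fun p : E × E => (extChartAt 𝓘(ℝ, E) (1 : G)).symm p.2) p :=
    ContMDiffAt.comp p (contMDiffAt_chart_symm 1 h2) contDiff_snd.contMDiff.contMDiffAt
  exact ContMDiffAt.comp p (contMDiffAt_chart 1 h) (e1.mul e2)

lemma contDiffAt_chartMul_left {a : E} (ha : a ∈ (extChartAt 𝓘(ℝ, E) (1 : G)).target) :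
    ContDiffAt ℝ ∞ (chartMul G) (a, chartOne E G) :=
  contDiffAt_chartMul ha chartOne_mem
    (by simpa only [symm_chartOne, mul_one] using (extChartAt 𝓘(ℝ, E) (1 : G)).map_target ha)

lemma contDiffAt_chartMul_right {a : E} (ha : a ∈ (extChartAt 𝓘(ℝ, E) (1 : G)).target) :
    ContDiffAt ℝ ∞ (chartMul G) (chartOne E G, a) :=
  contDiffAt_chartMul chartOne_mem ha
    (by simpa only [symm_chartOne, one_mul] using (extChartAt 𝓘(ℝ, E) (1 : G)).map_target ha)

lemma contDiffAt_chartLeft {a : E} (ha : a ∈ (extChartAt 𝓘(ℝ, E) (1 : G)).target) :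
    ContDiffAt ℝ ∞ (chartLeft G) a := by
  have h : ContDiffAt ℝ ∞ (fderiv ℝ (chartMul G)) (a, chartOne E G) :=
    (contDiffAt_chartMul_left ha).fderiv_right (by simp)
  exact (h.comp a (contDiffAt_id.prodMk contDiffAt_const)).clm_comp contDiffAt_const

lemma contDiffAt_chartRight {a : E} (ha : a ∈ (extChartAt 𝓘(ℝ, E) (1 : G)).target) :
    ContDiffAt ℝ ∞ (chartRight G) a := by
  have h : ContDiffAt ℝ ∞ (fderiv ℝ (chartMul G)) (chartOne E G, a) :=
    (contDiffAt_chartMul_right ha).fderiv_right (by simp)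
  exact (h.comp a (contDiffAt_const.prodMk contDiffAt_id)).clm_comp contDiffAt_const

lemma hasFDerivAt_chartMul_left {a : E} (ha : a ∈ (extChartAt 𝓘(ℝ, E) (1 : G)).target) :
    HasFDerivAt (fun b => chartMul G (a, b)) (chartLeft G a) (chartOne E G) :=
  HasFDerivAt.comp (chartOne E G)
    ((contDiffAt_chartMul_left ha).differentiableAt (by simp)).hasFDerivAt
    (hasFDerivAt_prodMk_right a (chartOne E G))

lemma hasFDerivAt_chartMul_right {a : E} (ha : a ∈ (extChartAt 𝓘(ℝ, E) (1 : G)).target) :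
    HasFDerivAt (fun b => chartMul G (b, a)) (chartRight G a) (chartOne E G) :=
  HasFDerivAt.comp (f := fun b => (b, a)) (chartOne E G)
    ((contDiffAt_chartMul_right ha).differentiableAt (by simp)).hasFDerivAt
    (hasFDerivAt_prodMk_left (chartOne E G) a)

lemma chartLeft_chartOne : chartLeft G (chartOne E G) = ContinuousLinearMap.id ℝ E := by
  refine (hasFDerivAt_chartMul_left (G := G) chartOne_mem).unique ?_
  refine (hasFDerivAt_id (𝕜 := ℝ) (chartOne E G)).congr_of_eventuallyEq ?_
  filter_upwards [target_mem_nhds_chartOne (E := E) (G := G)] with b hb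
  simp only [chartMul, symm_chartOne, one_mul,
    (extChartAt 𝓘(ℝ, E) (1 : G)).right_inv hb, id_eq]

lemma chartRight_chartOne : chartRight G (chartOne E G) = ContinuousLinearMap.id ℝ E := by
  refine (hasFDerivAt_chartMul_right (G := G) chartOne_mem).unique ?_
  refine (hasFDerivAt_id (𝕜 := ℝ) (chartOne E G)).congr_of_eventuallyEq ?_
  filter_upwards [target_mem_nhds_chartOne (E := E) (G := G)] with b hb
  simp only [chartMul, symm_chartOne, mul_one,
    (extChartAt 𝓘(ℝ, E) (1 : G)).right_inv hb, id_eq]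

/-- The symmetry of the second derivative of the multiplication. -/
lemma fderiv_chartRight (X Y : E) :
    fderiv ℝ (chartRight G) (chartOne E G) X Y = fderiv ℝ (chartLeft G) (chartOne E G) Y X := by
  have hs : IsSymmSndFDerivAt ℝ (chartMul G) (chartOne E G, chartOne E G) :=
    (contDiffAt_chartMul_left (G := G) chartOne_mem).isSymmSndFDerivAt
      (by simp only [minSmoothness_of_isRCLikeNormedField]; exact ENat.LEInfty.out)
  have hd : HasFDerivAt (fderiv ℝ (chartMul G))
      (fderiv ℝ (fderiv ℝ (chartMul G)) (chartOne E G, chartOne E G))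
      (chartOne E G, chartOne E G) :=
    (((contDiffAt_chartMul_left (G := G) chartOne_mem).fderiv_right (m := ∞)
      (by simp)).differentiableAt (by simp)).hasFDerivAt
  have hl : HasFDerivAt (chartLeft G) _ (chartOne E G) :=
    (HasFDerivAt.comp (f := fun b => (b, chartOne E G)) (chartOne E G) hd
      (hasFDerivAt_prodMk_left (chartOne E G) (chartOne E G))).clm_comp
      (hasFDerivAt_const (ContinuousLinearMap.inr ℝ E E) _)
  have hr : HasFDerivAt (chartRight G) _ (chartOne E G) :=
    (HasFDerivAt.comp (chartOne E G) hd
      (hasFDerivAt_prodMk_right (chartOne E G) (chartOne E G))).clm_comp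
      (hasFDerivAt_const (ContinuousLinearMap.inl ℝ E E) _)
  rw [hl.fderiv, hr.fderiv]
  simpa using hs _ _

end LieGroup

end

/-! ### The adjoint representation: homomorphism and smoothness -/

section

variable {E : Type*} [NormedAddCommGroup E] [NormedSpace ℝ E]
  {G : Type*} [TopologicalSpace G] [ChartedSpace E G] [Group G]

variable (E) in
/-- The adjoint representation, on the model space of the Lie group. -/
def adjoint (x : G) : E →L[ℝ] E := Ad 𝓘(ℝ, E) x

lemma adjoint_of_mem_center {x : G} (hx : x ∈ Subgroup.center G) :
    adjoint E x = ContinuousLinearMap.id ℝ E := by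
  have h : (fun y : G => x * y * x⁻¹) = id := by
    funext y
    simp [← Subgroup.mem_center_iff.1 hx y]
  unfold adjoint Ad
  rw [h]
  exact mfderiv_id

lemma adjoint_one : adjoint E (1 : G) = ContinuousLinearMap.id ℝ E :=
  adjoint_of_mem_center (Subgroup.one_mem _)

variable [LieGroup 𝓘(ℝ, E) ∞ G]

lemma contMDiff_conj (x : G) :
    ContMDiff 𝓘(ℝ, E) 𝓘(ℝ, E) ∞ (fun y : G => x * y * x⁻¹) :=
  (contMDiff_const.mul contMDiff_id).mul contMDiff_const

lemma hasFDerivAt_conj (x : G) :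
    HasFDerivAt (fun b : E => extChartAt 𝓘(ℝ, E) (1 : G)
      (x * (extChartAt 𝓘(ℝ, E) (1 : G)).symm b * x⁻¹)) (adjoint E x) (chartOne E G) := by
  have h1 : x * 1 * x⁻¹ = 1 := by simp
  have h : HasFDerivWithinAt (fun b : E => extChartAt 𝓘(ℝ, E) (x * 1 * x⁻¹)
      (x * (extChartAt 𝓘(ℝ, E) (1 : G)).symm b * x⁻¹)) (adjoint E x) (Set.range 𝓘(ℝ, E))
      (chartOne E G) :=
    ((contMDiff_conj (E := E) x).mdifferentiableAt (x := 1) (by simp)).hasMFDerivAt.2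
  rwa [h1, modelWithCornersSelf_coe, Set.range_id, hasFDerivWithinAt_univ] at h

lemma adjoint_mul (x y : G) : adjoint E (x * y) = (adjoint E x).comp (adjoint E y) := by
  refine (hasFDerivAt_conj (E := E) (x * y)).unique ?_
  have hy := hasFDerivAt_conj (E := E) y
  have e : chartOne E G = extChartAt 𝓘(ℝ, E) (1 : G)
      (y * (extChartAt 𝓘(ℝ, E) (1 : G)).symm (chartOne E G) * y⁻¹) := by
    rw [symm_chartOne, mul_one, mul_inv_cancel]; rfl
  have hx := e ▸ hasFDerivAt_conj (E := E) x
  refine (HasFDerivAt.comp (chartOne E G) hx hy).congr_of_eventuallyEq ?_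
  have hc : ContinuousAt (fun b : E => y * (extChartAt 𝓘(ℝ, E) (1 : G)).symm b * y⁻¹)
      (chartOne E G) :=
    ((contMDiff_conj (E := E) y).continuous.continuousAt).comp
      (contMDiffAt_chart_symm 1 chartOne_mem).continuousAt
  have hs := hc.preimage_mem_nhds (t := (extChartAt 𝓘(ℝ, E) (1 : G)).source)
    (by rw [symm_chartOne]; simpa using chart_source_mem_nhds E (1 : G))
  filter_upwards [hs] with b hb
  simp only [Function.comp, (extChartAt 𝓘(ℝ, E) (1 : G)).left_inv hb]
  group

/-- `Ad(x)` is the derivative in `y` at `1` of the jointly smooth map `x y x⁻¹`, and such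
derivatives are smooth in tangent coordinates. Source and target base points stay at `1`, so the
coordinate changes are trivial. -/
lemma contMDiff_adjoint :
    ContMDiff 𝓘(ℝ, E) 𝓘(ℝ, E →L[ℝ] E) ∞ (fun x : G => adjoint E x) := by
  intro x₀
  have hf : ContMDiffAt (𝓘(ℝ, E).prod 𝓘(ℝ, E)) 𝓘(ℝ, E) ∞
      (Function.uncurry fun x y : G => x * y * x⁻¹) (x₀, 1) :=
    ((contMDiffAt_fst.mul contMDiffAt_snd).mul contMDiffAt_fst.inv)
  have h : ContMDiffAt 𝓘(ℝ, E) 𝓘(ℝ, E →L[ℝ] E) ∞ (inTangentCoordinates 𝓘(ℝ, E) 𝓘(ℝ, E)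
      (fun _ : G => (1 : G)) (fun x : G => x * 1 * x⁻¹) (fun x => adjoint E x) x₀) x₀ :=
    ContMDiffAt.mfderiv (fun x y : G => x * y * x⁻¹) (fun _ => 1) hf
    (contMDiffAt_const (n := ∞)) (by simp)
  refine h.congr_of_eventuallyEq (Filter.Eventually.of_forall fun x => ?_)
  have h1 : ∀ x : G, x * 1 * x⁻¹ = 1 := by simp
  rw [inTangentCoordinates_eq]
  · ext v
    simp only [h1]
    rw [ContinuousLinearMap.comp_apply, ContinuousLinearMap.comp_apply]
    rw [(tangentBundleCore 𝓘(ℝ, E) G).coordChange_self,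
      (tangentBundleCore 𝓘(ℝ, E) G).coordChange_self]
    · exact mem_chart_source E (1 : G)
    · exact mem_chart_source E (1 : G)
  · simp
  · simp

end

/-! ### The Lie bracket as the differential of `Ad` -/

section

variable {E : Type*} [NormedAddCommGroup E] [NormedSpace ℝ E]
  {G : Type*} [TopologicalSpace G] [ChartedSpace E G] [Group G]

lemma hasMFDerivAt_of_hasFDerivAt_chart {M : Type*} [TopologicalSpace M] [ChartedSpace E M]
    {F : Type*} [NormedAddCommGroup F] [NormedSpace ℝ F] {f : M → F} {x : M}
    {f' : E →L[ℝ] F} (hc : ContinuousAt f x)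
    (hf : HasFDerivAt (f ∘ (extChartAt 𝓘(ℝ, E) x).symm) f' (extChartAt 𝓘(ℝ, E) x x)) :
    HasMFDerivAt 𝓘(ℝ, E) 𝓘(ℝ, F) f x f' :=
  ⟨hc, hf.hasFDerivWithinAt⟩

lemma mfderiv_apply_of_hasFDerivAt_chart {M : Type*} [TopologicalSpace M] [ChartedSpace E M]
    {F : Type*} [NormedAddCommGroup F] [NormedSpace ℝ F] {f : M → F} {x : M}
    {f' : E →L[ℝ] F} (hc : ContinuousAt f x)
    (hf : HasFDerivAt (f ∘ (extChartAt 𝓘(ℝ, E) x).symm) f' (extChartAt 𝓘(ℝ, E) x x)) (v : E) :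
    mfderiv 𝓘(ℝ, E) 𝓘(ℝ, F) f x v = f' v := by
  rw [(hasMFDerivAt_of_hasFDerivAt_chart hc hf).mfderiv]
  rfl

variable [LieGroup 𝓘(ℝ, E) ∞ G]

/-- Identifies left-invariant fields in the chart with the smooth fields `a ↦ chartLeft G a X`, on
which both the bracket and the integral curves are computed. -/
lemma mfderiv_chart_mulInvariantVectorField {g : G}
    (hg : g ∈ (extChartAt 𝓘(ℝ, E) (1 : G)).source) (X : GroupLieAlgebra 𝓘(ℝ, E) G) :
    mfderiv 𝓘(ℝ, E) 𝓘(ℝ, E) (extChartAt 𝓘(ℝ, E) (1 : G)) g (mulInvariantVectorField X g) =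
      chartLeft G (extChartAt 𝓘(ℝ, E) (1 : G) g) X := by
  have hL : MDifferentiableAt 𝓘(ℝ, E) 𝓘(ℝ, E) (fun y : G => g * y) 1 :=
    (contMDiff_mul_left (I := 𝓘(ℝ, E)) (n := ∞) (a := g)).mdifferentiableAt (by simp)
  have hc : MDifferentiableAt 𝓘(ℝ, E) 𝓘(ℝ, E) (extChartAt 𝓘(ℝ, E) (1 : G)) g :=
    (contMDiffAt_chart 1 hg).mdifferentiableAt (by simp)
  have h := mfderiv_comp_apply_of_eq (x := (1 : G)) (y := g) hc hL (mul_one _) X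
  refine h.symm.trans ?_
  have hL' := hasFDerivAt_chartMul_left ((extChartAt 𝓘(ℝ, E) (1 : G)).map_source hg)
  refine mfderiv_apply_of_hasFDerivAt_chart
    (ContinuousAt.comp_of_eq hc.continuousAt hL.continuousAt (mul_one _))
    (hL'.congr_of_eventuallyEq (Filter.Eventually.of_forall fun b => ?_)) X
  simp only [chartMul, (extChartAt 𝓘(ℝ, E) (1 : G)).left_inv hg]
  rfl

/-- This is `g y = (g y g⁻¹) g`, differentiated in `y` at the identity: `dL_g = dR_g ∘ Ad(g)`. -/
lemma chartLeft_eq {a : E} (ha : a ∈ (extChartAt 𝓘(ℝ, E) (1 : G)).target) :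
    chartLeft G a =
      (chartRight G a).comp (adjoint E ((extChartAt 𝓘(ℝ, E) (1 : G)).symm a)) := by
  refine (hasFDerivAt_chartMul_left (G := G) ha).unique ?_
  set g := (extChartAt 𝓘(ℝ, E) (1 : G)).symm a with hg
  have hr := hasFDerivAt_chartMul_right (G := G) ha
  have e : chartOne E G = extChartAt 𝓘(ℝ, E) (1 : G)
      (g * (extChartAt 𝓘(ℝ, E) (1 : G)).symm (chartOne E G) * g⁻¹) := by
    rw [symm_chartOne, mul_one, mul_inv_cancel]; rfl
  refine (HasFDerivAt.comp (f := fun b : E => extChartAt 𝓘(ℝ, E) (1 : G)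
      (g * (extChartAt 𝓘(ℝ, E) (1 : G)).symm b * g⁻¹)) (chartOne E G) (e ▸ hr)
    (hasFDerivAt_conj (E := E) g)).congr_of_eventuallyEq ?_
  have hc : ContinuousAt (fun b : E => g * (extChartAt 𝓘(ℝ, E) (1 : G)).symm b * g⁻¹)
      (chartOne E G) :=
    ((contMDiff_conj (E := E) g).continuous.continuousAt).comp
      (contMDiffAt_chart_symm 1 chartOne_mem).continuousAt
  have hs := hc.preimage_mem_nhds (t := (extChartAt 𝓘(ℝ, E) (1 : G)).source)
    (by rw [symm_chartOne]; simpa using chart_source_mem_nhds E (1 : G))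
  filter_upwards [hs] with b hb
  simp only [Function.comp, chartMul, (extChartAt 𝓘(ℝ, E) (1 : G)).left_inv hb, ← hg]
  group

variable (E G) in
/-- The differential of the adjoint representation at the identity, in the chart. -/
def adjointDeriv : E →L[ℝ] E →L[ℝ] E :=
  fderiv ℝ (fun a : E => adjoint E ((extChartAt 𝓘(ℝ, E) (1 : G)).symm a)) (chartOne E G)

lemma hasFDerivAt_adjoint : HasFDerivAt
    (fun a : E => adjoint E ((extChartAt 𝓘(ℝ, E) (1 : G)).symm a))
    (adjointDeriv E G) (chartOne E G) := by
  have h : ContMDiffAt 𝓘(ℝ, E) 𝓘(ℝ, E →L[ℝ] E) ∞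
      (fun a : E => adjoint E ((extChartAt 𝓘(ℝ, E) (1 : G)).symm a)) (chartOne E G) :=
    ContMDiffAt.comp _ contMDiff_adjoint.contMDiffAt (contMDiffAt_chart_symm 1 chartOne_mem)
  exact (h.contDiffAt.differentiableAt (by simp)).hasFDerivAt

/-- Both factors of `dR ∘ Ad` are the identity at `e`, so the product rule gives `D(dL) = D(dR) +
D(Ad)` there; `fderiv_chartRight` then trades `D(dR)` for `D(dL)` with swapped arguments. -/
lemma adjointDeriv_apply (X Y : E) : adjointDeriv E G X Y =
    fderiv ℝ (chartLeft G) (chartOne E G) X Y - fderiv ℝ (chartLeft G) (chartOne E G) Y X := by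
  have hl : HasFDerivAt (chartLeft G) (fderiv ℝ (chartLeft G) (chartOne E G)) (chartOne E G) :=
    ((contDiffAt_chartLeft (G := G) chartOne_mem).differentiableAt (by simp)).hasFDerivAt
  have hr : HasFDerivAt (chartRight G) (fderiv ℝ (chartRight G) (chartOne E G)) (chartOne E G) :=
    ((contDiffAt_chartRight (G := G) chartOne_mem).differentiableAt (by simp)).hasFDerivAt
  have h := hr.clm_comp (hasFDerivAt_adjoint (E := E) (G := G))
  have h' := h.congr_of_eventuallyEq (f₁ := chartLeft G) (by
    filter_upwards [target_mem_nhds_chartOne (E := E) (G := G)] with a ha using chartLeft_eq ha)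
  have := congrArg (fun T : E →L[ℝ] E →L[ℝ] E => T X Y) (hl.unique h')
  simp only [symm_chartOne, adjoint_one, chartRight_chartOne] at this
  simp only [← fderiv_chartRight] at this ⊢
  simp at this
  rw [this]
  abel

lemma mpullbackWithin_mulInvariantVectorField {a : E}
    (ha : a ∈ (extChartAt 𝓘(ℝ, E) (1 : G)).target) (X : GroupLieAlgebra 𝓘(ℝ, E) G) :
    VectorField.mpullbackWithin 𝓘(ℝ, E) 𝓘(ℝ, E) (extChartAt 𝓘(ℝ, E) (1 : G)).symm
      (mulInvariantVectorField X) (Set.range 𝓘(ℝ, E)) a = chartLeft G a X := by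
  have hinv := ContinuousLinearMap.inverse_eq
    (mfderivWithin_extChartAt_symm_comp_mfderiv_extChartAt (I := 𝓘(ℝ, E)) ha)
    (mfderiv_extChartAt_comp_mfderivWithin_extChartAt_symm (I := 𝓘(ℝ, E)) ha)
  have h := mfderiv_chart_mulInvariantVectorField
    ((extChartAt 𝓘(ℝ, E) (1 : G)).map_target ha) X
  rw [(extChartAt 𝓘(ℝ, E) (1 : G)).right_inv ha] at h
  refine Eq.trans ?_ h
  rw [VectorField.mpullbackWithin, hinv]

lemma lieBracketWithin_chartLeft {P Q : E → E} {X Y : E}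
    (hP : P =ᶠ[𝓝 (chartOne E G)] fun a => chartLeft G a X)
    (hQ : Q =ᶠ[𝓝 (chartOne E G)] fun a => chartLeft G a Y) :
    VectorField.lieBracketWithin ℝ P Q Set.univ (chartOne E G) = adjointDeriv E G X Y := by
  have hl : HasFDerivAt (chartLeft G) (fderiv ℝ (chartLeft G) (chartOne E G)) (chartOne E G) :=
    ((contDiffAt_chartLeft (G := G) chartOne_mem).differentiableAt (by simp)).hasFDerivAt
  have hd : ∀ Z : E, HasFDerivAt (fun a => chartLeft G a Z) _ (chartOne E G) := fun Z =>
    hl.clm_apply (hasFDerivAt_const Z _)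
  unfold VectorField.lieBracketWithin
  rw [fderivWithin_univ, fderivWithin_univ, hP.fderiv_eq, hQ.fderiv_eq, hP.eq_of_nhds,
    hQ.eq_of_nhds, (hd X).fderiv, (hd Y).fderiv, adjointDeriv_apply]
  simp [chartLeft_chartOne]

/-- The bracket of the Lie algebra is the differential of the adjoint representation. -/
lemma bracket_eq_adjointDeriv (X Y : GroupLieAlgebra 𝓘(ℝ, E) G) :
    ⁅X, Y⁆ = adjointDeriv E G X Y := by
  have hfield : ∀ Z : GroupLieAlgebra 𝓘(ℝ, E) G,
      (fun a : E => (VectorField.mpullbackWithin 𝓘(ℝ, E) 𝓘(ℝ, E)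
        (extChartAt 𝓘(ℝ, E) (1 : G)).symm
        (mulInvariantVectorField Z) (Set.range 𝓘(ℝ, E)) a : E)) =ᶠ[𝓝 (chartOne E G)]
      fun a => chartLeft G a Z := fun Z => by
    filter_upwards [target_mem_nhds_chartOne (E := E) (G := G)] with a ha
    exact mpullbackWithin_mulInvariantVectorField ha Z
  -- The chart at `1` has identity derivative at its own center, so transporting the bracket back
  -- from the chart changes nothing.
  have hinv : (mfderiv 𝓘(ℝ, E) 𝓘(ℝ, E) (extChartAt 𝓘(ℝ, E) (1 : G)) (1 : G)).inverse =
      ContinuousLinearMap.id ℝ _ := by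
    rw [mfderiv_extChartAt_self]
    exact ContinuousLinearMap.inverse_id
  have h0 : ⁅X, Y⁆ = VectorField.lieBracketWithin ℝ
      (fun a : E => (VectorField.mpullbackWithin 𝓘(ℝ, E) 𝓘(ℝ, E)
        (extChartAt 𝓘(ℝ, E) (1 : G)).symm
        (mulInvariantVectorField X) (Set.range 𝓘(ℝ, E)) a : E))
      (fun a : E => (VectorField.mpullbackWithin 𝓘(ℝ, E) 𝓘(ℝ, E)
        (extChartAt 𝓘(ℝ, E) (1 : G)).symm
        (mulInvariantVectorField Y) (Set.range 𝓘(ℝ, E)) a : E))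
      Set.univ (chartOne E G) := by
    rw [GroupLieAlgebra.bracket_def, ← VectorField.mlieBracketWithin_univ,
      VectorField.mlieBracketWithin_apply, hinv]
    simp only [Set.preimage_univ, Set.univ_inter, modelWithCornersSelf_coe, Set.range_id]
    rfl
  exact h0.trans (lieBracketWithin_chartLeft (E := E) (hfield X) (hfield Y))

end

/-! ### Invariant inner product and definiteness of the Killing form -/

section

section SkewTrace

variable {F : Type*} [AddCommGroup F] [Module ℝ F] {β : LinearMap.BilinForm ℝ F}

lemma trace_eq_sum_of_isOrtho {ι : Type*} [Fintype ι] {b : Module.Basis ι ℝ F}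
    (hb : LinearMap.IsOrthoᵢ β b) (hpos : ∀ v, v ≠ 0 → 0 < β v v) (A : F →ₗ[ℝ] F) :
    LinearMap.trace ℝ F A = ∑ i, β (A (b i)) (b i) / β (b i) (b i) := by
  classical
  rw [LinearMap.trace_eq_matrix_trace ℝ b, Matrix.trace]
  refine Finset.sum_congr rfl fun i _ => ?_
  rw [Matrix.diag_apply, LinearMap.toMatrix_apply, eq_div_iff (hpos _ (b.ne_zero i)).ne']
  conv_rhs => rw [← b.sum_repr (A (b i))]
  rw [map_sum, LinearMap.sum_apply, Finset.sum_eq_single i]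
  · simp
  · intro j _ hji
    have : β (b j) (b i) = 0 := hb hji
    simp [this]
  · simp

variable [FiniteDimensional ℝ F]

/-- In an orthogonal basis each diagonal term `β (A (b i)) (b i)` equals its own negative. -/
lemma trace_eq_zero_of_skew (hsymm : ∀ u v, β u v = β v u) (hpos : ∀ v, v ≠ 0 → 0 < β v v)
    {A : F →ₗ[ℝ] F} (hA : ∀ u v, β (A u) v = -β u (A v)) : LinearMap.trace ℝ F A = 0 := by
  obtain ⟨b, hb⟩ := LinearMap.BilinForm.exists_orthogonal_basis (B := β) ⟨fun u v => hsymm u v⟩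
  rw [trace_eq_sum_of_isOrtho hb hpos]
  refine Finset.sum_eq_zero fun i _ => ?_
  have h := hA (b i) (b i)
  rw [hsymm (b i) (A (b i))] at h
  rw [show β (A (b i)) (b i) = 0 by linarith, zero_div]

/-- By skewness `β (A² (b i)) (b i) = -β (A (b i)) (A (b i))`, so minus the trace is a sum of
nonnegative terms, and its vanishing kills every `A (b i)`. -/
lemma eq_zero_of_skew_of_trace_sq (hsymm : ∀ u v, β u v = β v u)
    (hpos : ∀ v, v ≠ 0 → 0 < β v v) {A : F →ₗ[ℝ] F} (hA : ∀ u v, β (A u) v = -β u (A v))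
    (htr : LinearMap.trace ℝ F (A ∘ₗ A) = 0) : A = 0 := by
  obtain ⟨b, hb⟩ := LinearMap.BilinForm.exists_orthogonal_basis (B := β) ⟨fun u v => hsymm u v⟩
  have hnonneg : ∀ v, 0 ≤ β v v := fun v => by
    rcases eq_or_ne v 0 with rfl | h
    · simp
    · exact (hpos v h).le
  rw [trace_eq_sum_of_isOrtho hb hpos, ← neg_eq_zero, ← Finset.sum_neg_distrib,
    Finset.sum_eq_zero_iff_of_nonneg] at htr
  · refine b.ext fun i => ?_
    by_contra hne
    have h := htr i (Finset.mem_univ i)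
    rw [LinearMap.comp_apply, hA, neg_div, neg_neg] at h
    exact (div_pos (hpos _ hne) (hpos _ (b.ne_zero i))).ne' h
  · intro i _
    rw [LinearMap.comp_apply, hA, neg_div, neg_neg]
    exact div_nonneg (hnonneg _) (hnonneg _)

end SkewTrace

variable {E : Type*} [NormedAddCommGroup E] [NormedSpace ℝ E]
  {G : Type*} [TopologicalSpace G] [ChartedSpace E G] [Group G] [LieGroup 𝓘(ℝ, E) ∞ G]

/-- The Killing form of the Lie algebra, computed on the model space. -/
lemma killingForm_eq [CompleteSpace E] (X Y : GroupLieAlgebra 𝓘(ℝ, E) G) :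
    killingForm ℝ (GroupLieAlgebra 𝓘(ℝ, E) G) X Y =
      LinearMap.trace ℝ E
        ((adjointDeriv E G X).toLinearMap ∘ₗ (adjointDeriv E G Y).toLinearMap) := by
  rw [killingForm_apply_apply]
  have h : ∀ Z : GroupLieAlgebra 𝓘(ℝ, E) G, LieAlgebra.ad ℝ (GroupLieAlgebra 𝓘(ℝ, E) G) Z =
      (adjointDeriv E G Z).toLinearMap := fun Z => LinearMap.ext fun W =>
    bracket_eq_adjointDeriv Z W
  rw [h, h]
  rfl

variable [FiniteDimensional ℝ E]

/-- On a compact group, averaging produces an inner product invariant under the adjoint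
representation. -/
lemma exists_invariant_form [CompactSpace G] : ∃ β : LinearMap.BilinForm ℝ E,
    (∀ u v, β u v = β v u) ∧ (∀ v, v ≠ 0 → 0 < β v v) ∧
    ∀ (g : G) (u v : E), β (adjoint E g u) (adjoint E g v) = β u v := by
  have : IsTopologicalGroup G := topologicalGroup_of_lieGroup 𝓘(ℝ, E) ∞
  let : MeasurableSpace G := borel G
  have : BorelSpace G := ⟨rfl⟩
  let μ : MeasureTheory.Measure G := MeasureTheory.Measure.haar
  -- With `g⁻¹` instead of `g`, applying `Ad(h)` to both arguments amounts to replacing `g` by `h⁻¹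
  -- g`, so left invariance of the Haar measure suffices.
  let q : G → E → E → ℝ := fun g u v =>
    inner ℝ (toEuclidean (adjoint E g⁻¹ u)) (toEuclidean (adjoint E g⁻¹ v))
  have hAd : Continuous fun g : G => adjoint E g := contMDiff_adjoint.continuous
  have hc : ∀ u v, Continuous fun g => q g u v := fun u v => by
    have h : ∀ w : E, Continuous fun g : G => toEuclidean (adjoint E g⁻¹ w) := fun w =>
      toEuclidean.continuous.comp ((hAd.comp continuous_inv).clm_apply continuous_const)
    exact (h u).inner (h v)
  have hi : ∀ u v, MeasureTheory.Integrable (fun g => q g u v) μ := fun u v =>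
    (hc u v).integrable_of_hasCompactSupport (HasCompactSupport.of_compactSpace _)
  refine ⟨LinearMap.mk₂ ℝ (fun u v => ∫ g, q g u v ∂μ) ?_ ?_ ?_ ?_, ?_, ?_, ?_⟩
  · intro u u' v
    rw [← MeasureTheory.integral_add (hi _ _) (hi _ _)]
    simp [q, inner_add_left]
  · intro c u v
    rw [smul_eq_mul, ← MeasureTheory.integral_const_mul]
    simp [q, inner_smul_left]
  · intro u v v'
    rw [← MeasureTheory.integral_add (hi _ _) (hi _ _)]
    simp [q, inner_add_right]
  · intro c u v
    rw [smul_eq_mul, ← MeasureTheory.integral_const_mul]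
    simp [q, inner_smul_right]
  · intro u v
    simp only [LinearMap.mk₂_apply, q]
    simp only [real_inner_comm]
  · intro v hv
    refine (hc v v).integral_pos_of_hasCompactSupport_nonneg_nonzero (x := 1)
      (HasCompactSupport.of_compactSpace _) (fun g => real_inner_self_nonneg) ?_
    simpa [q, adjoint_one] using hv
  · intro h u v
    simp only [LinearMap.mk₂_apply]
    rw [← MeasureTheory.integral_mul_left_eq_self (fun g => q g u v) h⁻¹]
    refine MeasureTheory.integral_congr_ae (Filter.Eventually.of_forall fun g => ?_)
    simp only [q, mul_inv_rev, inv_inv, adjoint_mul, ContinuousLinearMap.comp_apply]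

/-- Differentiate the constant function `g ↦ β (Ad(g) u) (Ad(g) v)` at the identity. -/
lemma adjointDeriv_skew {β : LinearMap.BilinForm ℝ E}
    (hβ : ∀ (g : G) (u v : E), β (adjoint E g u) (adjoint E g v) = β u v) (X u v : E) :
    β (adjointDeriv E G X u) v = -β u (adjointDeriv E G X v) := by
  let b : E →L[ℝ] E →L[ℝ] ℝ := LinearMap.toContinuousLinearMap
    ((LinearMap.toContinuousLinearMap : (E →ₗ[ℝ] ℝ) ≃ₗ[ℝ] E →L[ℝ] ℝ).toLinearMap ∘ₗ β)
  have hA := hasFDerivAt_adjoint (E := E) (G := G)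
  have hu := hA.clm_apply (hasFDerivAt_const u _)
  have hv := hA.clm_apply (hasFDerivAt_const v _)
  have h := b.hasFDerivAt_of_bilinear hu hv
  have h' : HasFDerivAt (fun _ : E => β u v) (0 : E →L[ℝ] ℝ) (chartOne E G) :=
    hasFDerivAt_const _ _
  have e := congrArg (fun T : E →L[ℝ] ℝ => T X)
    (h'.unique (h.congr_of_eventuallyEq (Filter.Eventually.of_forall fun a => (hβ _ u v).symm)))
  simp only [symm_chartOne, adjoint_one] at e
  simp [b] at e
  linarith

variable [CompactSpace G]

lemma trace_adjointDeriv (X : E) :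
    LinearMap.trace ℝ E (adjointDeriv E G X).toLinearMap = 0 := by
  obtain ⟨β, hsymm, hpos, hβ⟩ := exists_invariant_form (E := E) (G := G)
  exact trace_eq_zero_of_skew hsymm hpos (fun u v => adjointDeriv_skew hβ X u v)

variable [CompleteSpace E]

lemma eq_zero_of_killingForm_self
    (hG : LieAlgebra.HasTrivialRadical ℝ (GroupLieAlgebra 𝓘(ℝ, E) G))
    {X : GroupLieAlgebra 𝓘(ℝ, E) G}
    (hX : killingForm ℝ (GroupLieAlgebra 𝓘(ℝ, E) G) X X = 0) : X = 0 := by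
  obtain ⟨β, hsymm, hpos, hβ⟩ := exists_invariant_form (E := E) (G := G)
  rw [killingForm_eq] at hX
  have h := eq_zero_of_skew_of_trace_sq hsymm hpos (fun u v => adjointDeriv_skew hβ X u v) hX
  have hc : X ∈ LieAlgebra.center ℝ (GroupLieAlgebra 𝓘(ℝ, E) G) := by
    rw [LieModule.mem_maxTrivSubmodule]
    intro Y
    rw [← lie_skew, neg_eq_zero, bracket_eq_adjointDeriv]
    exact congrArg (fun T : E →ₗ[ℝ] E => T Y) h
  rwa [LieAlgebra.center_eq_bot, LieSubmodule.mem_bot] at hc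

end

/-! ### One-parameter subgroups -/

section

/-- Bootstrapping: `c' = f ∘ c` is as regular as `c`, so each order of smoothness yields the next.
-/
lemma contDiffOn_of_autonomous_ode {F : Type*} [NormedAddCommGroup F] [NormedSpace ℝ F]
    {f : F → F} {Ω : Set F} {c : ℝ → F} {U : Set ℝ} (hU : IsOpen U) (hf : ContDiffOn ℝ ∞ f Ω)
    (hc : ∀ t ∈ U, HasDerivAt c (f (c t)) t) (hm : Set.MapsTo c U Ω) : ContDiffOn ℝ ∞ c U := by
  rw [contDiffOn_infty]
  intro n
  induction n with
  | zero => exact contDiffOn_zero.2 fun t ht => (hc t ht).continuousAt.continuousWithinAt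
  | succ n ih =>
    push_cast
    rw [contDiffOn_succ_iff_deriv_of_isOpen hU]
    refine ⟨fun t ht => (hc t ht).differentiableAt.differentiableWithinAt, by simp, ?_⟩
    refine ((hf.of_le (by exact_mod_cast le_top)).comp ih hm).congr fun t ht => (hc t ht).deriv

section ListProd

variable {M : Type*} [Monoid M]

lemma prod_ofFn_eq_one {n : ℕ} {f : Fin n → M} (h : ∀ i, f i = 1) : (List.ofFn f).prod = 1 := by
  refine List.prod_eq_one fun y hy => ?_
  obtain ⟨i, rfl⟩ := (List.mem_ofFn' f y).1 hy
  exact h i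

lemma prod_ofFn_eq_single {n : ℕ} {f : Fin n → M} (j : Fin n) (h : ∀ i, i ≠ j → f i = 1) :
    (List.ofFn f).prod = f j := by
  induction n with
  | zero => exact j.elim0
  | succ n ih =>
    rw [List.ofFn_succ, List.prod_cons]
    cases j using Fin.cases with
    | zero => rw [prod_ofFn_eq_one fun i => h _ (Fin.succ_ne_zero i), mul_one]
    | succ j =>
      rw [h 0 (Fin.succ_ne_zero j).symm, one_mul]
      exact ih j fun i hi => h _ fun e => hi (Fin.succ_injective _ e)

lemma prod_ofFn_eq_pair {n : ℕ} {f : Fin n → M} {j k : Fin n} (hjk : j < k)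
    (h : ∀ i, i ≠ j → i ≠ k → f i = 1) : (List.ofFn f).prod = f j * f k := by
  induction n with
  | zero => exact j.elim0
  | succ n ih =>
    rw [List.ofFn_succ, List.prod_cons]
    cases k using Fin.cases with
    | zero => exact absurd hjk (Fin.not_lt_zero j)
    | succ k =>
      cases j using Fin.cases with
      | zero =>
        rw [prod_ofFn_eq_single k fun i hi => h _ (Fin.succ_ne_zero i)
          fun e => hi (Fin.succ_injective _ e)]
      | succ j =>
        rw [h 0 (Fin.succ_ne_zero j).symm (Fin.succ_ne_zero k).symm, one_mul]
        exact ih (Fin.succ_lt_succ_iff.1 hjk) fun i hi hi' =>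
          h _ (fun e => hi (Fin.succ_injective _ e)) fun e => hi' (Fin.succ_injective _ e)

end ListProd

variable {E : Type*} [NormedAddCommGroup E] [NormedSpace ℝ E]
  {G : Type*} [TopologicalSpace G] [ChartedSpace E G] [Group G] [LieGroup 𝓘(ℝ, E) ∞ G]

lemma contMDiff_prod_ofFn {E' : Type*} [NormedAddCommGroup E'] [NormedSpace ℝ E']
    {n : ℕ} {f : Fin n → E' → G} (hf : ∀ i, ContMDiff 𝓘(ℝ, E') 𝓘(ℝ, E) ∞ (f i)) :
    ContMDiff 𝓘(ℝ, E') 𝓘(ℝ, E) ∞ (fun p => (List.ofFn fun i => f i p).prod) := by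
  induction n with
  | zero => simpa using contMDiff_const
  | succ n ih =>
    simp only [List.ofFn_succ, List.prod_cons]
    exact (hf 0).mul (ih fun i => hf i.succ)

lemma mfderiv_mul_left_mulInvariantVectorField (g h : G) (X : GroupLieAlgebra 𝓘(ℝ, E) G) :
    mfderiv 𝓘(ℝ, E) 𝓘(ℝ, E) (fun y : G => g * y) h (mulInvariantVectorField X h) =
      mulInvariantVectorField X (g * h) := by
  have hd : ∀ a b : G, MDifferentiableAt 𝓘(ℝ, E) 𝓘(ℝ, E) (fun y : G => a * y) b := fun a b =>
    (contMDiff_mul_left (I := 𝓘(ℝ, E)) (n := ∞) (a := a)).mdifferentiableAt (by simp)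
  have e := mfderiv_comp_apply_of_eq (x := (1 : G)) (y := h) (hd g h) (hd h 1) (mul_one _) X
  have hc : (fun y : G => g * y) ∘ (fun y : G => h * y) = fun y : G => g * h * y := by
    funext y
    simp [mul_assoc]
  rw [hc] at e
  exact e.symm

lemma isMIntegralCurve_mul_left {γ : ℝ → G} {X : GroupLieAlgebra 𝓘(ℝ, E) G}
    (hγ : IsMIntegralCurve γ (mulInvariantVectorField (I := 𝓘(ℝ, E)) X)) (g : G) :
    IsMIntegralCurve (fun t => g * γ t) (mulInvariantVectorField (I := 𝓘(ℝ, E)) X) := by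
  intro t
  have hL : HasMFDerivAt 𝓘(ℝ, E) 𝓘(ℝ, E) (fun y : G => g * y) (γ t)
      (mfderiv 𝓘(ℝ, E) 𝓘(ℝ, E) (fun y : G => g * y) (γ t)) :=
    ((contMDiff_mul_left (I := 𝓘(ℝ, E)) (n := ∞) (a := g)).mdifferentiableAt
      (by simp)).hasMFDerivAt
  have h := hL.comp t (hγ t)
  have hlin : (mfderiv 𝓘(ℝ, E) 𝓘(ℝ, E) (fun y : G => g * y) (γ t)).comp
      ((1 : ℝ →L[ℝ] ℝ).smulRight (mulInvariantVectorField (I := 𝓘(ℝ, E)) X (γ t))) =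
      (1 : ℝ →L[ℝ] ℝ).smulRight (mulInvariantVectorField (I := 𝓘(ℝ, E)) X (g * γ t)) := by
    rw [← mfderiv_mul_left_mulInvariantVectorField]
    ext
    simp
  exact hlin ▸ h

variable [T2Space G]

lemma isMIntegralCurve_unique {γ δ : ℝ → G} {X : GroupLieAlgebra 𝓘(ℝ, E) G}
    (hγ : IsMIntegralCurve γ (mulInvariantVectorField (I := 𝓘(ℝ, E)) X))
    (hδ : IsMIntegralCurve δ (mulInvariantVectorField (I := 𝓘(ℝ, E)) X)) (h : γ 0 = δ 0) :
    γ = δ :=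
  isMIntegralCurve_Ioo_eq_of_contMDiff_boundaryless (t₀ := 0)
    ((contMDiff_mulInvariantVectorField X).of_le
      (by rw [minSmoothness_of_isRCLikeNormedField]; norm_num)) hγ hδ h

variable [CompleteSpace E]

/-- `lieExp` is defined through a chosen curve for each vector separately. Uniqueness of integral
curves identifies the curve chosen for `s • X` with the rescaled curve `γ (s ·)`. -/
lemma lieExp_smul_eq {γ : ℝ → G} {X : GroupLieAlgebra 𝓘(ℝ, E) G}
    (hγ : IsMIntegralCurve γ (mulInvariantVectorField (I := 𝓘(ℝ, E)) X)) (h : γ 0 = 1) (s : ℝ) :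
    lieExp 𝓘(ℝ, E) (s • X) = γ s := by
  have hs := (exists_oneParameter 𝓘(ℝ, E) (s • X)).choose_spec
  have h' := hγ.comp_mul s
  rw [← mulInvariantVectorField_smul] at h'
  have e := congrFun (isMIntegralCurve_unique hs.2 h' (by simp [hs.1, h])) 1
  simpa [lieExp] using e

lemma isMIntegralCurve_lieExp (X : GroupLieAlgebra 𝓘(ℝ, E) G) :
    IsMIntegralCurve (fun s : ℝ => lieExp 𝓘(ℝ, E) (s • X) : ℝ → G)
      (mulInvariantVectorField (I := 𝓘(ℝ, E)) X) := by
  obtain ⟨γ, h0, hγ⟩ := exists_oneParameter 𝓘(ℝ, E) X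
  rwa [show (fun s : ℝ => lieExp 𝓘(ℝ, E) (s • X) : ℝ → G) = γ from
    funext fun s => lieExp_smul_eq hγ h0 s]

lemma lieExp_zero_smul (X : GroupLieAlgebra 𝓘(ℝ, E) G) :
    lieExp 𝓘(ℝ, E) ((0 : ℝ) • X) = 1 := by
  obtain ⟨γ, h0, hγ⟩ := exists_oneParameter 𝓘(ℝ, E) X
  rw [lieExp_smul_eq hγ h0, h0]

/-- As functions of `b`, both sides are integral curves of the same left-invariant field with the
same value at `b = 0`. -/
lemma lieExp_add_smul (X : GroupLieAlgebra 𝓘(ℝ, E) G) (a b : ℝ) :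
    lieExp 𝓘(ℝ, E) ((a + b) • X) = lieExp 𝓘(ℝ, E) (a • X) * lieExp 𝓘(ℝ, E) (b • X) := by
  have h1 := (isMIntegralCurve_lieExp X).comp_add a
  have h2 := isMIntegralCurve_mul_left (isMIntegralCurve_lieExp X) (lieExp 𝓘(ℝ, E) (a • X))
  have e := congrFun (isMIntegralCurve_unique h1 h2
    (by simp only [Function.comp_apply, zero_add, lieExp_zero_smul, mul_one])) b
  simpa only [Function.comp_apply, add_comm b a] using e

end

/-! ### Smoothness of the exponential along lines and coordinates of the second kind -/

section

variable {E : Type*} [NormedAddCommGroup E] [NormedSpace ℝ E] [CompleteSpace E]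
  {G : Type*} [TopologicalSpace G] [ChartedSpace E G] [Group G] [LieGroup 𝓘(ℝ, E) ∞ G]
  [T2Space G]

lemma hasDerivAt_of_hasMFDerivAt {F : Type*} [NormedAddCommGroup F] [NormedSpace ℝ F]
    {c : ℝ → F} {t : ℝ} {T : ℝ →L[ℝ] F} (h : HasMFDerivAt 𝓘(ℝ, ℝ) 𝓘(ℝ, F) c t T) :
    HasDerivAt c (T 1) t := by
  have h' : HasFDerivAt c T t := h.hasFDerivAt
  exact h'.hasDerivAt

lemma continuous_lieExp_smul (X : GroupLieAlgebra 𝓘(ℝ, E) G) :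
    Continuous (fun s : ℝ => lieExp 𝓘(ℝ, E) (s • X) : ℝ → G) :=
  continuous_iff_continuousAt.2 fun t => (isMIntegralCurve_lieExp X t).continuousAt

lemma hasDerivAt_chart_lieExp (X : GroupLieAlgebra 𝓘(ℝ, E) G) {t : ℝ}
    (ht : lieExp 𝓘(ℝ, E) (t • X) ∈ (extChartAt 𝓘(ℝ, E) (1 : G)).source) :
    HasDerivAt (fun s : ℝ => extChartAt 𝓘(ℝ, E) (1 : G) (lieExp 𝓘(ℝ, E) (s • X)))
      (chartLeft G (extChartAt 𝓘(ℝ, E) (1 : G) (lieExp 𝓘(ℝ, E) (t • X))) X) t := by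
  have hc := ((contMDiffAt_chart (E := E) 1 ht).mdifferentiableAt (by simp)).hasMFDerivAt
  have h := (hc.comp t (isMIntegralCurve_lieExp X t))
  refine (hasDerivAt_of_hasMFDerivAt h).congr_deriv ?_
  rw [← mfderiv_chart_mulInvariantVectorField ht X]
  exact congrArg _ (one_smul ℝ _)

/-- Near `0` the curve stays in the chart at `1`, where it solves an autonomous equation with smooth
right-hand side. The group law then spreads smoothness to all times. -/
lemma contMDiffAt_lieExp_smul_zero (X : GroupLieAlgebra 𝓘(ℝ, E) G) :
    ContMDiffAt 𝓘(ℝ, ℝ) 𝓘(ℝ, E) ∞ (fun s : ℝ => lieExp 𝓘(ℝ, E) (s • X) : ℝ → G) 0 := by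
  set γ : ℝ → G := fun s => lieExp 𝓘(ℝ, E) (s • X) with hγ
  have hγ0 : γ 0 = 1 := lieExp_zero_smul X
  have hU : IsOpen (γ ⁻¹' (extChartAt 𝓘(ℝ, E) (1 : G)).source) :=
    (isOpen_extChartAt_source (1 : G)).preimage (continuous_lieExp_smul X)
  have h0 : (0 : ℝ) ∈ γ ⁻¹' (extChartAt 𝓘(ℝ, E) (1 : G)).source := by
    rw [Set.mem_preimage, hγ0]
    exact mem_extChartAt_source _
  have hf : ContDiffOn ℝ ∞ (fun a : E => chartLeft G a X)
      (extChartAt 𝓘(ℝ, E) (1 : G)).target := fun a ha =>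
    ((contDiffAt_chartLeft ha).clm_apply contDiffAt_const).contDiffWithinAt
  have hsm := contDiffOn_of_autonomous_ode hU hf
    (c := fun s => extChartAt 𝓘(ℝ, E) (1 : G) (γ s))
    (fun t ht => hasDerivAt_chart_lieExp X ht)
    (fun t ht => (extChartAt 𝓘(ℝ, E) (1 : G)).map_source ht)
  have hsm0 := (hsm.contDiffAt (hU.mem_nhds h0)).contMDiffAt
  have hs : ContMDiffAt 𝓘(ℝ, E) 𝓘(ℝ, E) ∞ (extChartAt 𝓘(ℝ, E) (1 : G)).symm
      (extChartAt 𝓘(ℝ, E) (1 : G) (γ 0)) :=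
    contMDiffAt_chart_symm 1 ((extChartAt 𝓘(ℝ, E) (1 : G)).map_source h0)
  refine (ContMDiffAt.comp (0 : ℝ) hs hsm0).congr_of_eventuallyEq ?_
  filter_upwards [hU.mem_nhds h0] with t ht
  exact ((extChartAt 𝓘(ℝ, E) (1 : G)).left_inv ht).symm

lemma contMDiff_lieExp_smul (X : GroupLieAlgebra 𝓘(ℝ, E) G) :
    ContMDiff 𝓘(ℝ, ℝ) 𝓘(ℝ, E) ∞ (fun s : ℝ => lieExp 𝓘(ℝ, E) (s • X) : ℝ → G) := by
  intro t
  have h : (fun s : ℝ => lieExp 𝓘(ℝ, E) (s • X) : ℝ → G) =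
      fun s => lieExp 𝓘(ℝ, E) (t • X) * lieExp 𝓘(ℝ, E) ((s - t) • X) := by
    funext s
    rw [← lieExp_add_smul, add_sub_cancel]
  rw [h]
  have hs : ContMDiffAt 𝓘(ℝ, ℝ) 𝓘(ℝ, ℝ) ∞ (fun s : ℝ => s - t) t :=
    (contDiffAt_id.sub contDiffAt_const).contMDiffAt
  exact contMDiffAt_const.mul
    (ContMDiffAt.comp_of_eq (contMDiffAt_lieExp_smul_zero X) hs (sub_self t))

lemma hasDerivAt_adjoint_lieExp (X : GroupLieAlgebra 𝓘(ℝ, E) G) :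
    HasDerivAt (fun s : ℝ => adjoint E (lieExp 𝓘(ℝ, E) (s • X) : G)) (adjointDeriv E G X) 0 := by
  have h0 : lieExp 𝓘(ℝ, E) ((0 : ℝ) • X) = (1 : G) := lieExp_zero_smul X
  have hm : lieExp 𝓘(ℝ, E) ((0 : ℝ) • X) ∈ (extChartAt 𝓘(ℝ, E) (1 : G)).source := by
    rw [h0]
    exact mem_extChartAt_source _
  have hc := hasDerivAt_chart_lieExp X hm
  have e : extChartAt 𝓘(ℝ, E) (1 : G) (lieExp 𝓘(ℝ, E) ((0 : ℝ) • X)) = chartOne E G := by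
    rw [h0]; rfl
  have hA := hasFDerivAt_adjoint (E := E) (G := G)
  rw [← e] at hA
  have h := hA.comp_hasDerivAt (0 : ℝ) hc
  rw [e, chartLeft_chartOne] at h
  refine h.congr_of_eventuallyEq ?_
  have hU := ((isOpen_extChartAt_source (I := 𝓘(ℝ, E)) (1 : G)).preimage
    (continuous_lieExp_smul X)).mem_nhds hm
  filter_upwards [hU] with t ht
  simp only [Function.comp, (extChartAt 𝓘(ℝ, E) (1 : G)).left_inv ht]

variable {n : ℕ} (Y : Fin n → GroupLieAlgebra 𝓘(ℝ, E) G) (x : G)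

lemma contMDiff_secondKind :
    ContMDiff 𝓘(ℝ, Fin n → ℝ) 𝓘(ℝ, E) ∞ (secondKind 𝓘(ℝ, E) Y x) := by
  refine contMDiff_const.mul (contMDiff_prod_ofFn fun i => ?_)
  have h : ContMDiff 𝓘(ℝ, Fin n → ℝ) 𝓘(ℝ, ℝ) ∞ (fun s : Fin n → ℝ => s i) :=
    (contDiff_apply ℝ ℝ i).contMDiff
  exact (contMDiff_lieExp_smul (Y i)).comp h

lemma secondKind_smul_single (j : Fin n) (a : ℝ) :
    secondKind 𝓘(ℝ, E) Y x (a • Pi.single j 1) = x * lieExp 𝓘(ℝ, E) (a • Y j) := by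
  unfold secondKind
  rw [prod_ofFn_eq_single j]
  · simp
  · intro i hi
    simp only [Pi.smul_apply, Pi.single_eq_of_ne hi, smul_zero, lieExp_zero_smul]

lemma secondKind_zero : secondKind 𝓘(ℝ, E) Y x 0 = x := by
  unfold secondKind
  rw [prod_ofFn_eq_one fun i => by rw [Pi.zero_apply, lieExp_zero_smul], mul_one]

/-- Along the `j`-th axis the map is a left-translated one-parameter subgroup, hence an integral
curve of `Y j`. -/
lemma mfderiv_secondKind (j : Fin n) :
    mfderiv 𝓘(ℝ, Fin n → ℝ) 𝓘(ℝ, E) (secondKind 𝓘(ℝ, E) Y x) 0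
      (Pi.single j (1 : ℝ) : Fin n → ℝ) =
    mulInvariantVectorField (Y j) (secondKind 𝓘(ℝ, E) Y x 0) := by
  have hcurve : IsMIntegralCurve
      (secondKind 𝓘(ℝ, E) Y x ∘ fun a : ℝ => a • (Pi.single j (1 : ℝ) : Fin n → ℝ))
      (mulInvariantVectorField (I := 𝓘(ℝ, E)) (Y j)) := by
    rw [show (secondKind 𝓘(ℝ, E) Y x ∘ fun a : ℝ => a • (Pi.single j (1 : ℝ) : Fin n → ℝ)) =
      fun a => x * lieExp 𝓘(ℝ, E) (a • Y j) from funext fun a => secondKind_smul_single Y x j a]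
    exact isMIntegralCurve_mul_left (isMIntegralCurve_lieExp (Y j)) x
  have hl : HasFDerivAt (fun a : ℝ => a • (Pi.single j (1 : ℝ) : Fin n → ℝ))
      ((1 : ℝ →L[ℝ] ℝ).smulRight (Pi.single j (1 : ℝ) : Fin n → ℝ)) 0 :=
    (((1 : ℝ →L[ℝ] ℝ).smulRight (Pi.single j (1 : ℝ) : Fin n → ℝ)).hasFDerivAt)
  have hd : MDifferentiableAt 𝓘(ℝ, Fin n → ℝ) 𝓘(ℝ, E) (secondKind 𝓘(ℝ, E) Y x)
      ((0 : ℝ) • (Pi.single j (1 : ℝ) : Fin n → ℝ)) :=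
    (contMDiff_secondKind Y x).mdifferentiableAt (by simp)
  have h := hd.hasMFDerivAt.comp (0 : ℝ) hl.hasMFDerivAt
  have e := congrArg (fun T : ℝ →L[ℝ] E => T 1) (hasMFDerivAt_unique (hcurve 0) h)
  have e' : (1 : ℝ) • mulInvariantVectorField (Y j)
      (secondKind 𝓘(ℝ, E) Y x ((0 : ℝ) • (Pi.single j (1 : ℝ) : Fin n → ℝ))) =
    mfderiv 𝓘(ℝ, Fin n → ℝ) 𝓘(ℝ, E) (secondKind 𝓘(ℝ, E) Y x)
      ((0 : ℝ) • (Pi.single j (1 : ℝ) : Fin n → ℝ))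
      ((1 : ℝ) • (Pi.single j (1 : ℝ) : Fin n → ℝ)) := e
  rw [zero_smul, one_smul, one_smul] at e'
  exact e'.symm

end

/-! ### Hessian calculus, the inverse function theorem, and `V` in coordinates of the second kind -/

section

section Calculus

variable {E F : Type*} [NormedAddCommGroup E] [NormedSpace ℝ E]
  [NormedAddCommGroup F] [NormedSpace ℝ F]

lemma hasFDerivAt_fderiv {F' : Type*} [NormedAddCommGroup F'] [NormedSpace ℝ F'] {f : F → F'}
    {p : F} (hf : ContDiffAt ℝ ∞ f p) :
    HasFDerivAt (fderiv ℝ f) (fderiv ℝ (fderiv ℝ f) p) p :=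
  ((hf.fderiv_right (m := ∞) (by simp)).differentiableAt (by simp)).hasFDerivAt

/-- Differentiating in `b` and then in `a` touches each curve once, so first derivatives of `P` and
`Q` suffice. The case `v = w` is allowed, which covers the diagonal entries of the Hessian. -/
lemma hessian_of_separated {A : Type*} [NormedAddCommGroup A] [NormedSpace ℝ A]
    {f : F → ℝ} (hf : ContDiff ℝ ∞ f) {v w : F} (β : A →L[ℝ] A →L[ℝ] ℝ) {P Q : ℝ → A} {P' Q' : A}
    (h : ∀ a b : ℝ, f (a • v + b • w) = β (P a) (Q b))
    (hP : HasDerivAt P P' 0) (hQ : HasDerivAt Q Q' 0) :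
    hessian f 0 v w = β P' Q' := by
  have h1 : ∀ a : ℝ, fderiv ℝ f (a • v) w = β.flip Q' (P a) := fun a => by
    have hl : HasDerivAt (fun b : ℝ => a • v + b • w) w 0 := by
      simpa using ((hasDerivAt_id (0 : ℝ)).smul_const w).const_add (a • v)
    have hfa : HasFDerivAt f (fderiv ℝ f (a • v)) (a • v + (0 : ℝ) • w) := by
      rw [zero_smul, add_zero]
      exact (hf.differentiable (by simp) (a • v)).hasFDerivAt
    have e1 := hfa.comp_hasDerivAt (0 : ℝ) hl
    have e2 := (β (P a)).hasFDerivAt.comp_hasDerivAt (0 : ℝ) hQ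
    exact e1.unique (e2.congr_of_eventuallyEq (Filter.Eventually.of_forall fun b => h a b))
  have hl : HasDerivAt (fun a : ℝ => a • v) v 0 := by
    simpa using (hasDerivAt_id (0 : ℝ)).smul_const v
  have hff : HasFDerivAt (fun z => fderiv ℝ f z w) ((hessian f 0).flip w) ((0 : ℝ) • v) := by
    rw [zero_smul]
    exact (ContinuousLinearMap.apply ℝ ℝ w).hasFDerivAt.comp (0 : F)
      (hasFDerivAt_fderiv hf.contDiffAt)
  have e1 := hff.comp_hasDerivAt (0 : ℝ) hl
  have e2 := (β.flip Q').hasFDerivAt.comp_hasDerivAt (0 : ℝ) hP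
  exact e1.unique (e2.congr_of_eventuallyEq (Filter.Eventually.of_forall fun a => h1 a))

/-- At a critical point the Hessian is natural under smooth changes of variables. -/
lemma hessian_comp {f : E → ℝ} {h : F → E} {p : F} (hf : ContDiffAt ℝ ∞ f (h p))
    (hh : ContDiffAt ℝ ∞ h p) (hcrit : fderiv ℝ f (h p) = 0) (v w : F) :
    hessian (f ∘ h) p v w = hessian f (h p) (fderiv ℝ h p v) (fderiv ℝ h p w) := by
  have hd : ∀ᶠ s in 𝓝 p, fderiv ℝ (f ∘ h) s = (fderiv ℝ f (h s)).comp (fderiv ℝ h s) := by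
    have h1 : ∀ᶠ s in 𝓝 p, ContDiffAt ℝ 1 h s :=
      (hh.of_le (by exact_mod_cast le_top)).eventually (by simp)
    have h2 : ∀ᶠ s in 𝓝 p, ContDiffAt ℝ 1 f (h s) :=
      hh.continuousAt.eventually ((hf.of_le (by exact_mod_cast le_top)).eventually (by simp))
    filter_upwards [h1, h2] with s h1 h2
    exact fderiv_comp s (h2.differentiableAt (by simp)) (h1.differentiableAt (by simp))
  have h1 := (hasFDerivAt_fderiv hf).comp p (hh.differentiableAt (by simp)).hasFDerivAt
  have h2 := h1.clm_comp (hasFDerivAt_fderiv hh)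
  have h3 := (h2.congr_of_eventuallyEq hd).fderiv
  unfold hessian
  rw [h3]
  simp [hcrit]

/-- The inverse function theorem for a map from a normed space to a manifold. -/
lemma isLocalDiffeomorphAt_of_hasFDerivAt_chart [CompleteSpace F]
    {M : Type*} [TopologicalSpace M] [ChartedSpace E M] [IsManifold 𝓘(ℝ, E) ∞ M]
    {f : F → M} (hf : ContMDiff 𝓘(ℝ, F) 𝓘(ℝ, E) ∞ f) {p : F} {e : F ≃L[ℝ] E}
    (he : HasFDerivAt (fun s => extChartAt 𝓘(ℝ, E) (f p) (f s)) (e : F →L[ℝ] E) p) :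
    IsLocalDiffeomorphAt 𝓘(ℝ, F) 𝓘(ℝ, E) ∞ f p := by
  set φ := extChartAt 𝓘(ℝ, E) (f p) with hφ
  set h : F → E := fun s => φ (f s) with hh
  have hsm : ∀ s, f s ∈ φ.source → ContDiffAt ℝ ∞ h s := fun s hs =>
    (ContMDiffAt.comp s (contMDiffAt_extChartAt' (by simpa [hφ] using hs)) (hf s)).contDiffAt
  have hp : f p ∈ φ.source := mem_extChartAt_source _
  let Θ := (hsm p hp).toOpenPartialHomeomorph h he (by simp)
  have hΘ : (Θ : F → E) = h := rfl
  have hpΘ : p ∈ Θ.source := (hsm p hp).mem_toOpenPartialHomeomorph_source he (by simp)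
  -- A local diffeomorphism needs a smooth inverse on a whole neighborhood, so the source is shrunk
  -- to points where the derivative is still invertible.
  have hinv : ∀ᶠ s in 𝓝 p, fderiv ℝ h s ∈ Set.range ((↑) : (F ≃L[ℝ] E) → F →L[ℝ] E) := by
    have hc : ContinuousAt (fderiv ℝ h) p := (hasFDerivAt_fderiv (hsm p hp)).continuousAt
    refine hc.eventually ?_
    rw [he.fderiv]
    exact ContinuousLinearEquiv.nhds e
  have hsrc : ∀ᶠ s in 𝓝 p, f s ∈ φ.source :=
    hf.continuous.continuousAt.eventually ((isOpen_extChartAt_source (f p)).mem_nhds hp)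
  obtain ⟨W, hWsub, hWo, hpW⟩ := mem_nhds_iff.1 (hinv.and hsrc)
  let Ψ := (Θ.restrOpen W hWo).trans (chartAt E (f p)).symm
  have hsymm : ∀ s ∈ W, (chartAt E (f p)).symm (h s) = f s := fun s hs =>
    φ.left_inv (hWsub hs).2
  have hΨW : ∀ s ∈ Ψ.source, s ∈ W := fun s hs => hs.1.2
  refine ⟨⟨Ψ.toPartialEquiv, Ψ.open_source, Ψ.open_target, ?_, ?_⟩, ?_, ?_⟩
  · exact hf.contMDiffOn.congr fun s hs => hsymm s (hΨW s hs)
  · intro y hy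
    have hy1 : y ∈ (chartAt E (f p)).source := hy.1
    have hy2 : chartAt E (f p) y ∈ (Θ.restrOpen W hWo).target := hy.2
    have hyW : Θ.symm (chartAt E (f p) y) ∈ W := ((Θ.restrOpen W hWo).map_target hy2).2
    obtain ⟨⟨e', he'⟩, hs⟩ := hWsub hyW
    have hΘs : ContDiffAt ℝ ∞ Θ.symm (chartAt E (f p) y) := by
      refine Θ.contDiffAt_symm (f₀' := e') hy2.1 ?_ (hsm _ hs)
      rw [he']
      exact ((hsm _ hs).differentiableAt (by simp)).hasFDerivAt
    have hc : ContMDiffAt 𝓘(ℝ, E) 𝓘(ℝ, E) ∞ (chartAt E (f p)) y :=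
      contMDiffAt_extChartAt' (I := 𝓘(ℝ, E)) hy1
    exact (ContMDiffAt.comp y hΘs.contMDiffAt hc).contMDiffWithinAt
  · exact ⟨⟨hpΘ, hpW⟩, mem_chart_target E (f p)⟩
  · exact fun s hs => (hsymm s (hΨW s hs)).symm

end Calculus

variable {E : Type*} [NormedAddCommGroup E] [NormedSpace ℝ E] [FiniteDimensional ℝ E]

variable (E) in
/-- The trace as a continuous linear form on the continuous endomorphisms. -/
def traceCLM : (E →L[ℝ] E) →L[ℝ] ℝ :=
  LinearMap.toContinuousLinearMap (LinearMap.trace ℝ E ∘ₗ ContinuousLinearMap.coeLM ℝ)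

lemma traceCLM_comp_comm (A B : E →L[ℝ] E) : traceCLM E (A.comp B) = traceCLM E (B.comp A) :=
  LinearMap.trace_mul_comm ℝ A.toLinearMap B.toLinearMap

variable {G : Type*} [TopologicalSpace G] [ChartedSpace E G] [Group G]

lemma V_eq_traceCLM (g : G) : V 𝓘(ℝ, E) g = traceCLM E (adjoint E g) := rfl

variable [LieGroup 𝓘(ℝ, E) ∞ G]

lemma contMDiff_V : ContMDiff 𝓘(ℝ, E) 𝓘(ℝ, ℝ) ∞ (V 𝓘(ℝ, E) : G → ℝ) :=
  (traceCLM E).contDiff.contMDiff.comp contMDiff_adjoint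

lemma V_mul_of_mem_center {x : G} (hx : x ∈ Subgroup.center G) (g : G) :
    V 𝓘(ℝ, E) (x * g) = V 𝓘(ℝ, E) g := by
  rw [V_eq_traceCLM, V_eq_traceCLM, adjoint_mul, adjoint_of_mem_center hx,
    ContinuousLinearMap.id_comp]

variable (E) in
/-- The differential at the identity of left translation by `x`, on the model space. -/
def leftDeriv (x : G) : E →L[ℝ] E := mfderiv 𝓘(ℝ, E) 𝓘(ℝ, E) (fun y : G => x * y) 1

lemma leftDeriv_bijective (x : G) : Function.Bijective (leftDeriv E x) := by
  have hd : ∀ a b : G, MDifferentiableAt 𝓘(ℝ, E) 𝓘(ℝ, E) (fun y : G => a * y) b := fun a b =>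
    (contMDiff_mul_left (I := 𝓘(ℝ, E)) (n := ∞) (a := a)).mdifferentiableAt (by simp)
  have hinj : Function.Injective (leftDeriv E x) := by
    let R : E →L[ℝ] E := mfderiv 𝓘(ℝ, E) 𝓘(ℝ, E) (fun y : G => x⁻¹ * y) x
    refine Function.LeftInverse.injective (g := R) fun v => ?_
    have e := mfderiv_comp_apply_of_eq (x := (1 : G)) (y := x) (hd x⁻¹ x) (hd x 1) (mul_one _) v
    have hc : (fun y : G => x⁻¹ * y) ∘ (fun y : G => x * y) = id := by
      funext y
      simp
    rw [hc, mfderiv_id] at e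
    exact e.symm
  exact ⟨hinj, (LinearMap.injective_iff_surjective (f := (leftDeriv E x).toLinearMap)).1 hinj⟩

section SecondKind

variable [CompleteSpace E] [T2Space G] {n : ℕ} {x : G}

/-- The product carries the factors in index order. For `j < k` this is the stated order; for `j =
k` the group law splits the single factor; for `j > k` cyclicity of the trace swaps the two. -/
lemma V_secondKind (hx : x ∈ Subgroup.center G) (Y : Fin n → GroupLieAlgebra 𝓘(ℝ, E) G)
    (j k : Fin n) (a b : ℝ) :
    V 𝓘(ℝ, E) (secondKind 𝓘(ℝ, E) Y x (a • Pi.single j 1 + b • Pi.single k 1)) =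
      traceCLM E ((adjoint E (lieExp 𝓘(ℝ, E) (a • Y j) : G)).comp
        (adjoint E (lieExp 𝓘(ℝ, E) (b • Y k) : G))) := by
  have hlt : ∀ {j k : Fin n} (a b : ℝ), j < k →
      secondKind 𝓘(ℝ, E) Y x (a • Pi.single j 1 + b • Pi.single k 1) =
        x * (lieExp 𝓘(ℝ, E) (a • Y j) * lieExp 𝓘(ℝ, E) (b • Y k)) := fun {j k} a b hjk => by
    unfold secondKind
    rw [prod_ofFn_eq_pair hjk]
    · simp [Pi.single_eq_of_ne hjk.ne, Pi.single_eq_of_ne hjk.ne']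
    · intro i hi hi'
      simp only [Pi.add_apply, Pi.smul_apply, Pi.single_eq_of_ne hi, Pi.single_eq_of_ne hi',
        smul_zero, add_zero, lieExp_zero_smul]
  rcases lt_trichotomy j k with hjk | rfl | hjk
  · rw [hlt a b hjk, V_mul_of_mem_center hx, V_eq_traceCLM, adjoint_mul]
  · rw [← add_smul, secondKind_smul_single, V_mul_of_mem_center hx, lieExp_add_smul,
      V_eq_traceCLM, adjoint_mul]
  · rw [add_comm, hlt b a hjk, V_mul_of_mem_center hx, V_eq_traceCLM, adjoint_mul,
      traceCLM_comp_comm]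

lemma contDiff_V_secondKind (Y : Fin n → GroupLieAlgebra 𝓘(ℝ, E) G) :
    ContDiff ℝ ∞ (V 𝓘(ℝ, E) ∘ secondKind 𝓘(ℝ, E) Y x) :=
  (contMDiff_V.comp (contMDiff_secondKind Y x)).contDiff

lemma hessian_V_secondKind (hx : x ∈ Subgroup.center G)
    (Y : Fin n → GroupLieAlgebra 𝓘(ℝ, E) G) (j k : Fin n) :
    hessian (V 𝓘(ℝ, E) ∘ secondKind 𝓘(ℝ, E) Y x) 0 (Pi.single j 1) (Pi.single k 1) =
      killingForm ℝ (GroupLieAlgebra 𝓘(ℝ, E) G) (Y j) (Y k) := by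
  rw [killingForm_eq]
  exact hessian_of_separated (contDiff_V_secondKind Y)
    ((ContinuousLinearMap.compL ℝ (E →L[ℝ] E) (E →L[ℝ] E) ℝ (traceCLM E)).comp
      (ContinuousLinearMap.compL ℝ E E E)) (fun a b => V_secondKind hx Y j k a b)
    (hasDerivAt_adjoint_lieExp (Y j)) (hasDerivAt_adjoint_lieExp (Y k))

/-- The `j`-th partial derivative is `tr (ad Y_j)`, which vanishes by skewness. -/
lemma fderiv_V_secondKind [CompactSpace G] (hx : x ∈ Subgroup.center G)
    (Y : Fin n → GroupLieAlgebra 𝓘(ℝ, E) G) :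
    fderiv ℝ (V 𝓘(ℝ, E) ∘ secondKind 𝓘(ℝ, E) Y x) 0 = 0 := by
  refine ContinuousLinearMap.coe_inj.1 ((Pi.basisFun ℝ (Fin n)).ext fun j => ?_)
  rw [Pi.basisFun_apply]
  have hl : HasDerivAt (fun a : ℝ => a • (Pi.single j (1 : ℝ) : Fin n → ℝ)) (Pi.single j 1) 0 := by
    simpa using (hasDerivAt_id (0 : ℝ)).smul_const (Pi.single j (1 : ℝ) : Fin n → ℝ)
  have hf : HasFDerivAt (V 𝓘(ℝ, E) ∘ secondKind 𝓘(ℝ, E) Y x)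
      (fderiv ℝ (V 𝓘(ℝ, E) ∘ secondKind 𝓘(ℝ, E) Y x) 0)
      ((0 : ℝ) • (Pi.single j (1 : ℝ) : Fin n → ℝ)) := by
    rw [zero_smul]
    exact ((contDiff_V_secondKind Y).differentiable (by simp) 0).hasFDerivAt
  have e1 := hf.comp_hasDerivAt (0 : ℝ) hl
  have e2 := (traceCLM E).hasFDerivAt.comp_hasDerivAt (0 : ℝ) (hasDerivAt_adjoint_lieExp (Y j))
  refine (e1.unique (e2.congr_of_eventuallyEq (Filter.Eventually.of_forall fun a => ?_))).trans
    (trace_adjointDeriv (E := E) (G := G) (Y j))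
  simp only [Function.comp_apply]
  rw [secondKind_smul_single, V_mul_of_mem_center hx, V_eq_traceCLM]

/-- The coordinates of the second kind, read in the chart at the base point. -/
lemma hasFDerivAt_chart_secondKind (Y : Module.Basis (Fin n) ℝ (GroupLieAlgebra 𝓘(ℝ, E) G)) :
    ∃ e : (Fin n → ℝ) ≃L[ℝ] E,
      HasFDerivAt (fun s => extChartAt 𝓘(ℝ, E) x (secondKind 𝓘(ℝ, E) Y x s))
        (e : (Fin n → ℝ) →L[ℝ] E) 0 := by
  let L : E ≃ₗ[ℝ] E := LinearEquiv.ofBijective (leftDeriv E x).toLinearMap (leftDeriv_bijective x)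
  let Y' : (Fin n → ℝ) ≃ₗ[ℝ] E := Y.equivFun.symm
  -- The differential at `0` must send the `j`-th basis vector to `dL_x (Y j)`: the coordinates of
  -- the basis `Y`, followed by left translation.
  let e : (Fin n → ℝ) ≃L[ℝ] E := (Y'.trans L).toContinuousLinearEquiv
  refine ⟨e, ?_⟩
  have hd : MDifferentiableAt 𝓘(ℝ, Fin n → ℝ) 𝓘(ℝ, E) (secondKind 𝓘(ℝ, E) Y x) 0 :=
    (contMDiff_secondKind Y x).mdifferentiableAt (by simp)
  have h0 : secondKind 𝓘(ℝ, E) Y x 0 = x := secondKind_zero Y x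
  let D : (Fin n → ℝ) →L[ℝ] E :=
    mfderiv 𝓘(ℝ, Fin n → ℝ) 𝓘(ℝ, E) (secondKind 𝓘(ℝ, E) Y x) 0
  have hD : HasFDerivWithinAt
      (fun s => extChartAt 𝓘(ℝ, E) (secondKind 𝓘(ℝ, E) Y x 0) (secondKind 𝓘(ℝ, E) Y x s))
      D (Set.range 𝓘(ℝ, Fin n → ℝ)) 0 := hd.hasMFDerivAt.2
  rw [h0, modelWithCornersSelf_coe, Set.range_id, hasFDerivWithinAt_univ] at hD
  have hDe : D = (e : (Fin n → ℝ) →L[ℝ] E) := by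
    refine ContinuousLinearMap.coe_inj.1 ((Pi.basisFun ℝ (Fin n)).ext fun j => ?_)
    rw [Pi.basisFun_apply]
    have e1 : D (Pi.single j 1) = leftDeriv E (secondKind 𝓘(ℝ, E) Y x 0) (Y j) :=
      mfderiv_secondKind Y x j
    have hY : Y.equivFun.symm (Pi.single j 1) = Y j := by
      rw [Y.equivFun_symm_apply, Finset.sum_eq_single j] <;> simp +contextual
    have e2 : e (Pi.single j 1) = leftDeriv E x (Y j) := congrArg (leftDeriv E x) hY
    rw [h0] at e1
    exact e1.trans e2.symm
  rwa [hDe] at hD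

end SecondKind

end

/-! ### Non-degeneracy of `V` at central points and isolation in the critical set -/

section

variable {E : Type*} [NormedAddCommGroup E] [NormedSpace ℝ E] [FiniteDimensional ℝ E]
  {G : Type*} [TopologicalSpace G] [ChartedSpace E G] [Group G] [LieGroup 𝓘(ℝ, E) ∞ G]

lemma contDiffAt_V_chart (x : G) {a : E} (ha : a ∈ (extChartAt 𝓘(ℝ, E) x).target) :
    ContDiffAt ℝ ∞ ((V 𝓘(ℝ, E) : G → ℝ) ∘ (extChartAt 𝓘(ℝ, E) x).symm) a :=
  (ContMDiffAt.comp a contMDiff_V.contMDiffAt (contMDiffAt_chart_symm x ha)).contDiffAt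

lemma fderiv_V_chart_eq_zero {x w : G} (hw : w ∈ (extChartAt 𝓘(ℝ, E) x).source)
    (h : mfderiv 𝓘(ℝ, E) 𝓘(ℝ, ℝ) (V 𝓘(ℝ, E) : G → ℝ) w = 0) :
    fderiv ℝ ((V 𝓘(ℝ, E) : G → ℝ) ∘ (extChartAt 𝓘(ℝ, E) x).symm)
      (extChartAt 𝓘(ℝ, E) x w) = 0 := by
  have hw' := (extChartAt 𝓘(ℝ, E) x).map_source hw
  have hV : MDifferentiableAt 𝓘(ℝ, E) 𝓘(ℝ, ℝ) (V 𝓘(ℝ, E) : G → ℝ) w :=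
    contMDiff_V.mdifferentiableAt (by simp)
  have hs : MDifferentiableAt 𝓘(ℝ, E) 𝓘(ℝ, E) (extChartAt 𝓘(ℝ, E) x).symm
      (extChartAt 𝓘(ℝ, E) x w) :=
    (contMDiffAt_chart_symm x hw').mdifferentiableAt (by simp)
  ext v
  have e := mfderiv_comp_apply_of_eq (x := extChartAt 𝓘(ℝ, E) x w) (y := w) hV hs
    ((extChartAt 𝓘(ℝ, E) x).left_inv hw) v
  rw [h, mfderiv_eq_fderiv] at e
  exact e

/-- A non-degenerate critical point is isolated among the critical points. -/
lemma eventually_eq_of_mfderiv_V_eq_zero {x : G}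
    (h : IsNondegenerateCriticalPoint 𝓘(ℝ, E) (V 𝓘(ℝ, E) : G → ℝ) x) :
    ∀ᶠ w in 𝓝 x, mfderiv 𝓘(ℝ, E) 𝓘(ℝ, ℝ) (V 𝓘(ℝ, E) : G → ℝ) w = 0 → w = x := by
  set φ := extChartAt 𝓘(ℝ, E) x with hφ
  set f : E → ℝ := (V 𝓘(ℝ, E) : G → ℝ) ∘ φ.symm with hf
  have hd : HasFDerivAt (fderiv ℝ f) (hessian f (φ x)) (φ x) :=
    hasFDerivAt_fderiv (contDiffAt_V_chart x (mem_extChartAt_target x))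
  have hker : (hessian f (φ x)).toLinearMap.ker = ⊥ := by
    rw [LinearMap.ker_eq_bot']
    exact fun v hv => h.nondegenerate v fun w =>
      congrArg (fun T : E →L[ℝ] ℝ => T w) hv
  -- In finite dimension an injective Hessian is bounded below, so `fderiv ℝ f` avoids the value `0`
  -- on a punctured neighborhood.
  obtain ⟨K, -, hK⟩ := LinearMap.exists_antilipschitzWith _ hker
  have hne := hd.eventually_ne (c := 0) ⟨K, hK⟩
  rw [eventually_nhdsWithin_iff] at hne
  have hφc : ContinuousAt φ x := continuousAt_extChartAt x
  filter_upwards [hφc.eventually hne, extChartAt_source_mem_nhds (I := 𝓘(ℝ, E)) x] with w hw hs hz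
  by_contra hwx
  exact hw (fun e => hwx (φ.injOn hs (mem_extChartAt_source x) e)) (fderiv_V_chart_eq_zero hs hz)

/-- Applying `dV` to `W(t, w) = 0` gives `∑ a_k(t, w)² = 0`, so `dV_w` kills every `Ad(xr(t)) X_k`
at `w`; by regularity these fill the tangent space. -/
lemma mfderiv_V_eq_zero_of_mem_criticalSet {m : ℕ} {X : Fin m → GroupLieAlgebra 𝓘(ℝ, E) G}
    {xr : ℝ → G} (hreg : IsRegular 𝓘(ℝ, E) X xr) {w : G}
    (hw : w ∈ criticalSet 𝓘(ℝ, E) X xr) :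
    mfderiv 𝓘(ℝ, E) 𝓘(ℝ, ℝ) (V 𝓘(ℝ, E) : G → ℝ) w = 0 := by
  let D : E →L[ℝ] ℝ := mfderiv 𝓘(ℝ, E) 𝓘(ℝ, ℝ) (V 𝓘(ℝ, E) : G → ℝ) w
  have hzero : ∀ t k, D (leftDeriv E w (adjoint E (xr t) (X k))) = 0 := fun t => by
    have h : ∑ k, D (leftDeriv E w (adjoint E (xr t) (X k))) •
        leftDeriv E w (adjoint E (xr t) (X k)) = 0 := hw t
    have h' := congrArg D h
    rw [map_sum, map_zero] at h'
    simp only [map_smul, smul_eq_mul] at h'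
    rw [Finset.sum_eq_zero_iff_of_nonneg fun k _ => mul_self_nonneg _] at h'
    exact fun k => mul_self_eq_zero.1 (h' k (Finset.mem_univ k))
  have hspan : Submodule.span ℝ
      (Set.range fun p : ℝ × Fin m => adjoint E (xr p.1) (X p.2)) = ⊤ := hreg
  have hcomp : D.comp (leftDeriv E w) = 0 :=
    ContinuousLinearMap.coe_inj.1 (LinearMap.ext_on_range hspan fun p => hzero p.1 p.2)
  have hD : D = 0 := by
    ext v
    obtain ⟨u, rfl⟩ := (leftDeriv_bijective (E := E) w).2 v
    exact congrArg (fun T : E →L[ℝ] ℝ => T u) hcomp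
  exact hD

variable [CompleteSpace E] [T2Space G]

lemma isLocalDiffeomorphAt_secondKind {n : ℕ} (x : G)
    (Y : Module.Basis (Fin n) ℝ (GroupLieAlgebra 𝓘(ℝ, E) G)) :
    IsLocalDiffeomorphAt 𝓘(ℝ, Fin n → ℝ) 𝓘(ℝ, E) ∞ (secondKind 𝓘(ℝ, E) Y x) 0 := by
  obtain ⟨e, he⟩ := hasFDerivAt_chart_secondKind (x := x) Y
  refine isLocalDiffeomorphAt_of_hasFDerivAt_chart (contMDiff_secondKind Y x) (e := e) ?_
  rwa [secondKind_zero Y x]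

variable [CompactSpace G]

/-- In coordinates of the second kind the Hessian is the Killing form. Criticality must be
established first, since only then does `hessian_comp` carry the Hessian over to the preferred
chart. -/
theorem isNondegenerateCriticalPoint_V
    (hG : LieAlgebra.HasTrivialRadical ℝ (GroupLieAlgebra 𝓘(ℝ, E) G))
    {x : G} (hx : x ∈ Subgroup.center G) :
    IsNondegenerateCriticalPoint 𝓘(ℝ, E) (V 𝓘(ℝ, E) : G → ℝ) x := by
  let Y : Module.Basis (Fin (Module.finrank ℝ E)) ℝ (GroupLieAlgebra 𝓘(ℝ, E) G) :=
    Module.finBasis ℝ E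
  obtain ⟨e, he⟩ := hasFDerivAt_chart_secondKind (x := x) Y
  set φ := extChartAt 𝓘(ℝ, E) x with hφ
  set f : E → ℝ := (V 𝓘(ℝ, E) : G → ℝ) ∘ φ.symm with hf
  set h : (Fin (Module.finrank ℝ E) → ℝ) → E := fun s => φ (secondKind 𝓘(ℝ, E) Y x s) with hh
  have hx0 : secondKind 𝓘(ℝ, E) Y x 0 = x := secondKind_zero Y x
  have hh0 : h 0 = φ x := congrArg φ hx0
  have hsrc : secondKind 𝓘(ℝ, E) Y x 0 ∈ φ.source := by
    rw [hx0]
    exact mem_extChartAt_source _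
  have hhs : ContDiffAt ℝ ∞ h 0 :=
    (ContMDiffAt.comp 0 (contMDiffAt_chart x hsrc) (contMDiff_secondKind Y x 0)).contDiffAt
  have hfs : ContDiffAt ℝ ∞ f (h 0) := contDiffAt_V_chart x (φ.map_source hsrc)
  have hcomp : (V 𝓘(ℝ, E) ∘ secondKind 𝓘(ℝ, E) Y x) =ᶠ[𝓝 0] f ∘ h := by
    have := (contMDiff_secondKind Y x).continuous.continuousAt.eventually
      ((isOpen_extChartAt_source x).mem_nhds hsrc)
    filter_upwards [this] with s hs
    simp only [hf, hh, Function.comp_apply, φ.left_inv hs]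
  have hcrit : fderiv ℝ f (h 0) = 0 := by
    have h1 := fderiv_V_secondKind hx Y
    rw [hcomp.fderiv_eq, fderiv_comp 0 (hfs.differentiableAt (by simp))
      (hhs.differentiableAt (by simp)), he.fderiv] at h1
    ext v
    simpa using congrArg (fun T : (Fin (Module.finrank ℝ E) → ℝ) →L[ℝ] ℝ => T (e.symm v)) h1
  have hhess : ∀ v w, hessian (V 𝓘(ℝ, E) ∘ secondKind 𝓘(ℝ, E) Y x) 0 v w =
      hessian f (φ x) (e v) (e w) := fun v w => by
    have h1 := hessian_comp hfs hhs hcrit v w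
    rw [he.fderiv, hh0] at h1
    refine Eq.trans ?_ h1
    unfold hessian
    rw [hcomp.fderiv.fderiv_eq]
  refine ⟨Filter.Eventually.of_forall fun y => contMDiff_V y, ?_, fun v hv => ?_⟩
  · have hd : HasFDerivAt f (0 : E →L[ℝ] ℝ) (φ x) := by
      rw [← hh0, ← hcrit]
      exact (hfs.differentiableAt (by simp)).hasFDerivAt
    exact (hasMFDerivAt_of_hasFDerivAt_chart contMDiff_V.continuous.continuousAt hd).mfderiv
  · set s := e.symm v with hs
    -- Pairing `v` with itself is enough, because the Killing form is definite and not merely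
    -- non-degenerate.
    have hks : hessian (V 𝓘(ℝ, E) ∘ secondKind 𝓘(ℝ, E) Y x) 0 s s = 0 := by
      rw [hhess, hs, e.apply_symm_apply]
      exact hv v
    have hsum : s = ∑ i, s i • (Pi.single i 1 : Fin (Module.finrank ℝ E) → ℝ) :=
      pi_eq_sum_univ' s
    have hK : killingForm ℝ (GroupLieAlgebra 𝓘(ℝ, E) G) (∑ i, s i • Y i) (∑ i, s i • Y i) = 0 := by
      rw [← hks]
      conv_rhs => rw [hsum]
      simp only [map_sum, map_smul, LinearMap.sum_apply, LinearMap.smul_apply,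
        sum_apply, smul_apply, hessian_V_secondKind hx Y]
    have h0 := eq_zero_of_killingForm_self hG hK
    rw [← Y.equivFun_symm_apply, LinearEquiv.map_eq_zero_iff] at h0
    rw [hs] at h0
    simpa using h0

lemma isIsolatedPoint_criticalSet
    (hG : LieAlgebra.HasTrivialRadical ℝ (GroupLieAlgebra 𝓘(ℝ, E) G))
    {x : G} (hx : x ∈ Subgroup.center G) {m : ℕ} {X : Fin m → GroupLieAlgebra 𝓘(ℝ, E) G}
    {xr : ℝ → G} (hreg : IsRegular 𝓘(ℝ, E) X xr) :
    IsIsolatedPoint (criticalSet 𝓘(ℝ, E) X xr) x := by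
  have h := isNondegenerateCriticalPoint_V hG hx
  have hmem : x ∈ criticalSet 𝓘(ℝ, E) X xr := fun t => by
    refine Finset.sum_eq_zero fun k _ => ?_
    rw [feedback, h.critical]
    exact zero_smul ℝ _
  obtain ⟨U, hU, hUo, hxU⟩ := mem_nhds_iff.1 (eventually_eq_of_mfderiv_V_eq_zero h)
  refine ⟨hmem, U, hUo, Set.Subset.antisymm ?_ (Set.singleton_subset_iff.2 ⟨hxU, hmem⟩)⟩
  exact fun w hw => hU hw.1 (mfderiv_V_eq_zero_of_mem_criticalSet hreg hw.2)

end

end LieTracking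

end

theorem mainTheorem4
    {E : Type*} [NormedAddCommGroup E] [NormedSpace ℝ E] [FiniteDimensional ℝ E] [CompleteSpace E]
    {G : Type*} [TopologicalSpace G] [ChartedSpace E G] [Group G] [LieGroup 𝓘(ℝ, E) ∞ G]
    [T2Space G] [CompactSpace G] [ConnectedSpace G]
    (hG : LieAlgebra.HasTrivialRadical ℝ (GroupLieAlgebra 𝓘(ℝ, E) G))
    (x : G) (hx : x ∈ Subgroup.center G) :
    LieTracking.IsNondegenerateCriticalPoint 𝓘(ℝ, E) (LieTracking.V 𝓘(ℝ, E) : G → ℝ) x ∧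
    (∀ (n : ℕ) (Y : Module.Basis (Fin n) ℝ (GroupLieAlgebra 𝓘(ℝ, E) G)),
      LieTracking.secondKind 𝓘(ℝ, E) Y x 0 = x ∧
      IsLocalDiffeomorphAt 𝓘(ℝ, Fin n → ℝ) 𝓘(ℝ, E) ∞
        (LieTracking.secondKind 𝓘(ℝ, E) Y x) 0 ∧
      (∀ j, mfderiv 𝓘(ℝ, Fin n → ℝ) 𝓘(ℝ, E) (LieTracking.secondKind 𝓘(ℝ, E) Y x) 0
          (Pi.single j (1 : ℝ) : Fin n → ℝ) =
        mulInvariantVectorField (Y j) (LieTracking.secondKind 𝓘(ℝ, E) Y x 0)) ∧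
      ∀ j k, LieTracking.hessian
          (LieTracking.V 𝓘(ℝ, E) ∘ LieTracking.secondKind 𝓘(ℝ, E) Y x) 0
          (Pi.single j 1) (Pi.single k 1) =
        killingForm ℝ (GroupLieAlgebra 𝓘(ℝ, E) G) (Y j) (Y k)) ∧
    (∀ (m : ℕ) (X : Fin m → GroupLieAlgebra 𝓘(ℝ, E) G)
      (xr : ℝ → G) (ur : Fin m → ℝ → ℝ) (T : ℝ),
      LieTracking.IsPeriodicTrajectory 𝓘(ℝ, E) X xr ur T →
      LieTracking.IsRegular 𝓘(ℝ, E) X xr →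
      LieTracking.IsIsolatedPoint (LieTracking.criticalSet 𝓘(ℝ, E) X xr) x) := by
  exact ⟨LieTracking.isNondegenerateCriticalPoint_V hG hx,
    fun n Y => ⟨LieTracking.secondKind_zero Y x, LieTracking.isLocalDiffeomorphAt_secondKind x Y,
      LieTracking.mfderiv_secondKind Y x, LieTracking.hessian_V_secondKind hx Y⟩,
    fun m X xr ur T _ hreg => LieTracking.isIsolatedPoint_criticalSet hG hx hreg⟩
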